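/- Consider the class of equations $$u_t+\alpha(t)u^nu_x+\beta(t)u_{xxx}+\sigma(t)u_{xxxxx}=0,$$ whose arbitrary elements are a nonzero integer $n$ and smooth nowhere vanishing functions $\alpha,\beta,\sigma$ of $t$. For $n<0$ the equation is considered only where $u\neq0$. The *usual equivalence group* $G^{\sim}$ of the class consists of the (local) smooth nondegenerate point transformations of the variables $(t,x,u)$ and of the arbitrary elements, $$(\tilde t,\tilde x,\tilde u)=(T,X,U)(t,x,u),\qquad (\tilde\alpha,\tilde\beta,\tilde\sigma,\tilde n)=(A,B,S,N)(t,x,u,\alpha,\beta,\sigma,n),$$ whose components for $t,x,u$ do not involve the arbitrary elements, and which map every equation of the class to an equation of the same class: for all arbitrary elements $(\alpha,\beta,\sigma,n)$, the transformed ones are again a nonzero integer $\tilde n$ and smooth nowhere vanishing functions $\tilde\alpha,\tilde\beta,\tilde\sigma$ of $\tilde t$ alone, and the fifth prolongation of $(T,X,U)$ maps the manifold of the equation with elements $(\alpha,\beta,\sigma,n)$ in the jet space to that of the equation with elements $(\tilde\alpha,\tilde\beta,\tilde\sigma,\tilde n)$. **Theorem.** Over any nonempty open convex domain $\Omega$ of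 the space of $(t,x,u)$, the group $G^{\sim}$ consists exactly of the transformations $$\tilde t=T(t),\quad \tilde x=\delta_1x+\delta_2,\quad \tilde u=\delta_3u,$$ $$\tilde\alpha(\tilde t)=\frac{\delta_1}{\delta_3^{\,n}\,T_t}\,\alpha(t),\quad \tilde\beta(\tilde t)=\frac{\delta_1^3}{T_t}\,\beta(t),\quad \tilde\sigma(\tilde t)=\frac{\delta_1^5}{T_t}\,\sigma(t),\quad \tilde n=n,$$ where $\delta_1,\delta_2,\delta_3$ are arbitrary real constants with $\delta_1\delta_3\neq0$ and $T$ is an arbitrary smooth function of $t$ (on the projection of $\Omega$ to the $t$-axis) with $T_t\neq0$ everywhere. The same holds for every subclass in which $n$ ranges over a given nonempty set of nonzero integers, in particular for each fixed $n$. -/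

import Mathlib

open Set Filter Topology
open scoped ContDiff

namespace Kawahara

/-- The arbitrary elements `(α, β, σ, n)` of the class of equations
`u_t + α(t) u^n u_x + β(t) u_xxx + σ(t) u_xxxxx = 0`. -/
structure Elements where
  α : ℝ → ℝ
  β : ℝ → ℝ
  σ : ℝ → ℝ
  n : ℤ

/-- `θ` parameterizes an equation of the class over the time interval `I` with exponent in `E`:
the coefficients are smooth and nonvanishing on `I`. -/
structure InClass (E : Set ℤ) (I : Set ℝ) (θ : Elements) : Prop where
  smooth_α : ContDiffOn ℝ ∞ θ.α I
  smooth_β : ContDiffOn ℝ ∞ θ.β I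
  smooth_σ : ContDiffOn ℝ ∞ θ.σ I
  α_ne_zero : ∀ t ∈ I, θ.α t ≠ 0
  β_ne_zero : ∀ t ∈ I, θ.β t ≠ 0
  σ_ne_zero : ∀ t ∈ I, θ.σ t ≠ 0
  n_mem : θ.n ∈ E

/-- The function `u` satisfies the equation with arbitrary elements `θ` at the point `(t, x)`,
that is, the 5-jet of `u` at `(t, x)` lies on the manifold defined by the equation in the
fifth-order jet space. For `n < 0` the equation is defined only where `u ≠ 0`. -/
def SatisfiesAt (θ : Elements) (u : ℝ → ℝ → ℝ) (t x : ℝ) : Prop :=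
  (θ.n < 0 → u t x ≠ 0) ∧
    deriv (fun s => u s x) t + θ.α t * u t x ^ θ.n * deriv (u t) x
      + θ.β t * iteratedDeriv 3 (u t) x + θ.σ t * iteratedDeriv 5 (u t) x = 0

/-- A transformation of the variables `z = (t, x, u)` and of the arbitrary elements
`c = (α, β, σ)` and `n`, with the components for `t`, `x`, `u` projectible on the space of
`(t, x, u)`. -/
structure Transformation where
  T : ℝ × ℝ × ℝ → ℝ
  X : ℝ × ℝ × ℝ → ℝ
  U : ℝ × ℝ × ℝ → ℝ
  A : ℝ × ℝ × ℝ → ℝ × ℝ × ℝ → ℤ → ℝ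
  B : ℝ × ℝ × ℝ → ℝ × ℝ × ℝ → ℤ → ℝ
  S : ℝ × ℝ × ℝ → ℝ × ℝ × ℝ → ℤ → ℝ
  N : ℝ × ℝ × ℝ → ℝ × ℝ × ℝ → ℤ → ℤ

/-- The admissible values of `(α, β, σ)` at a point. -/
def coeffSpace : Set (ℝ × ℝ × ℝ) := {c | c.1 ≠ 0 ∧ c.2.1 ≠ 0 ∧ c.2.2 ≠ 0}

/-- The transformation in the space of `(t, x, u, α, β, σ)`, for a given value of `n`. -/
def Transformation.extended (Φ : Transformation) (n : ℤ) (p : (ℝ × ℝ × ℝ) × (ℝ × ℝ × ℝ)) :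
    (ℝ × ℝ × ℝ) × (ℝ × ℝ × ℝ) :=
  ((Φ.T p.1, Φ.X p.1, Φ.U p.1), (Φ.A p.1 p.2 n, Φ.B p.1 p.2 n, Φ.S p.1 p.2 n))

/-- The new independent variables `(T, X)` along the graph of `u`. -/
def Transformation.alongGraph (Φ : Transformation) (u : ℝ → ℝ → ℝ) (q : ℝ × ℝ) : ℝ × ℝ :=
  (Φ.T (q.1, q.2, u q.1 q.2), Φ.X (q.1, q.2, u q.1 q.2))

/-- Near the point over `(t, x)`, the transformation maps the graph of `u` to the graph of `v`:
the new independent variables are local coordinates on the graph of `u` (so that `v` is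
determined by `u` and its jet is the prolonged transformation of the jet of `u`), and
`v (T, X) = U` along the graph of `u`. -/
def Transformation.MapsGraphAt (Φ : Transformation) (u v : ℝ → ℝ → ℝ) (t x : ℝ) : Prop :=
  Function.Bijective (fderiv ℝ (Φ.alongGraph u) (t, x)) ∧
    ∀ᶠ q in 𝓝 (t, x),
      v (Φ.alongGraph u q).1 (Φ.alongGraph u q).2 = Φ.U (q.1, q.2, u q.1 q.2)

/-- On the domain `Ω`, the (prolonged) point transformation of `(t, x, u)` maps the equation with
arbitrary elements `θ` to the equation with arbitrary elements `θ'`. -/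
def Transformation.MapsEquation (Φ : Transformation) (Ω : Set (ℝ × ℝ × ℝ))
    (θ θ' : Elements) : Prop :=
  ∀ (u v : ℝ → ℝ → ℝ) (t x : ℝ), (t, x, u t x) ∈ Ω →
    ContDiffAt ℝ ∞ (Function.uncurry u) (t, x) →
    ContDiffAt ℝ ∞ (Function.uncurry v) (Φ.alongGraph u (t, x)) →
    Φ.MapsGraphAt u v t x →
    (SatisfiesAt θ u t x ↔
      SatisfiesAt θ' v (Φ.alongGraph u (t, x)).1 (Φ.alongGraph u (t, x)).2)

/-- `Φ`, considered over the domain `Ω` of the space of `(t, x, u)`, belongs to the usual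
equivalence group of the class with exponents in `E`: it is a smooth nondegenerate point
transformation of the variables and of the arbitrary elements, and it maps every equation of the
class to an equation of the class, namely the one with the transformed arbitrary elements. -/
structure IsUsualEquivalence (E : Set ℤ) (Ω : Set (ℝ × ℝ × ℝ)) (Φ : Transformation) : Prop where
  smooth : ∀ n ∈ E, ContDiffOn ℝ ∞ (Φ.extended n) (Ω ×ˢ coeffSpace)
  nondegenerate : ∀ n ∈ E, ∀ p ∈ Ω ×ˢ coeffSpace,
    Function.Bijective (fderiv ℝ (Φ.extended n) p)
  maps_class : ∀ θ : Elements, InClass E (Prod.fst '' Ω) θ →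
    ∃ θ' : Elements, InClass E (Φ.T '' Ω) θ' ∧
      (∀ z ∈ Ω,
        θ'.α (Φ.T z) = Φ.A z (θ.α z.1, θ.β z.1, θ.σ z.1) θ.n ∧
        θ'.β (Φ.T z) = Φ.B z (θ.α z.1, θ.β z.1, θ.σ z.1) θ.n ∧
        θ'.σ (Φ.T z) = Φ.S z (θ.α z.1, θ.β z.1, θ.σ z.1) θ.n ∧
        θ'.n = Φ.N z (θ.α z.1, θ.β z.1, θ.σ z.1) θ.n) ∧
      Φ.MapsEquation Ω θ θ'

end Kawahara

namespace Kawahara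

/-! Necessity uses only constant-coefficient equations, tested on polynomials. Let `u` and `w` take
the same value at a point and satisfy the same equation there. Both transforms satisfy the target
equation at the image point and have equal values there, so the nonlinear coefficient `α' U ^ n'` is
common, and their difference `d` satisfies a linear relation between `d_t`, `d_x`, `d_xxx`,
`d_xxxxx` (`exists_variation`). Along the graph of `w`, `d` equals `c (w - u)` with `c ≠ 0` up to a
smaller error (`variation_isLittleO`). Choosing `w - u` therefore prescribes the Taylor coefficients
of `d`, and each choice isolates one determining equation.

The difference `(t - t₀)^5` forces `T_x = T_u = 0` (`fderiv_T_eq_zero`). The difference `(x - x₀)^5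
- 120 σ (t - t₀)` gives `σ' T_t = σ (X_x + q X_u)^5` for generic slopes `q = u_x`; hence `X_u = 0`,
and `X_x` depends on `t` only (`fderiv_X_eq_zero`). The difference `(x - x₀)^4` gives `U_ux + q U_uu
= 0` for all `q`, so `U` is affine in `u` with slope depending on `t` only
(`fderiv_U_slope_eq_zero`). Linear and cubic differences, balanced in `t`, give `α' U^n' T_t = α u^n
X_x + X_t` and `β' T_t = β X_x^3` (`alpha_beta_relation`).

The transform of a constant does not depend on the coefficients but must solve the image of every
equation; varying signs makes its first derivatives vanish, so `U_t = U_x = 0` (`fderiv_U_eq_zero`).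
With `U = δ₃ u + δ₀`, comparing the two powers of `u` (`zpow_affine_rigidity`) gives `n' = n`, and
`δ₀ = X_t = 0` unless `n = 1`. For `n = 1` a Galilean boost survives for one equation, but its
velocity is proportional to `α`; since `X` and `U` may not depend on `α`, replacing `α` by `-α`
excludes it.

These relations are derived where `u ≠ 0`, extended by continuity, and integrated using convexity of
`Ω`. Sufficiency is the chain rule together with inversion of `τ` on an interval. -/

/-! ### Taylor coefficients from asymptotic expansions. -/

theorem natCast_le_infty (k : ℕ) : (k : WithTop ℕ∞) ≤ ∞ := by
  exact_mod_cast (le_top : (k : ℕ∞) ≤ ⊤)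

/-- The limit at `0` kills the constant term; dividing by `s` on the punctured neighbourhood then
lowers the degree by one. -/
theorem polynomial_coeff_eq_zero_of_isLittleO (N : ℕ) :
    ∀ a : ℕ → ℝ, (fun s : ℝ => ∑ k ∈ Finset.range (N + 1), a k * s ^ k) =o[𝓝[≠] 0]
      (fun s : ℝ => s ^ N) → ∀ k ≤ N, a k = 0 := by
  induction N with
  | zero =>
    intro a h k hk
    obtain rfl : k = 0 := by omega
    simpa [Asymptotics.isLittleO_const_const_iff] using h
  | succ N ih =>
    intro a h
    have h0 : a 0 = 0 := by
      have h1 : Tendsto (fun s : ℝ => ∑ k ∈ Finset.range (N + 1 + 1), a k * s ^ k) (𝓝[≠] 0)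
          (𝓝 (∑ k ∈ Finset.range (N + 1 + 1), a k * (0 : ℝ) ^ k)) := by
        have : Continuous fun s : ℝ => ∑ k ∈ Finset.range (N + 1 + 1), a k * s ^ k := by fun_prop
        exact (this.tendsto 0).mono_left nhdsWithin_le_nhds
      have h2 : Tendsto (fun s : ℝ => s ^ (N + 1)) (𝓝[≠] 0) (𝓝 0) := by
        have : Continuous fun s : ℝ => s ^ (N + 1) := by fun_prop
        simpa using (this.tendsto 0).mono_left nhdsWithin_le_nhds
      have h3 := tendsto_nhds_unique h1 (h.trans_tendsto h2)
      rw [Finset.sum_range_succ'] at h3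
      simpa using h3
    have h4 : (fun s : ℝ => ∑ k ∈ Finset.range (N + 1), a (k + 1) * s ^ k) =o[𝓝[≠] 0]
        (fun s : ℝ => s ^ N) := by
      have h5 := (Asymptotics.isBigO_refl (fun s : ℝ => s⁻¹) (𝓝[≠] 0)).mul_isLittleO h
      refine h5.congr' ?_ ?_
      · filter_upwards [self_mem_nhdsWithin] with s hs
        rw [Finset.sum_range_succ', h0, zero_mul, add_zero, Finset.mul_sum]
        refine Finset.sum_congr rfl fun k _ => ?_
        have : s ≠ 0 := hs
        field_simp
        ring
      · filter_upwards [self_mem_nhdsWithin] with s hs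
        have : s ≠ 0 := hs
        field_simp
        ring
    have h6 := ih (fun k => a (k + 1)) h4
    intro k hk
    rcases k with _ | k
    · exact h0
    · exact h6 k (by omega)

/-- A Taylor expansion determines the iterated derivatives. -/
theorem iteratedDeriv_eq_of_isLittleO {N : ℕ} {h : ℝ → ℝ} (hh : ContDiffAt ℝ N h 0) {c : ℕ → ℝ}
    (hc : (fun s : ℝ => h s - ∑ k ∈ Finset.range (N + 1), c k * s ^ k) =o[𝓝 0]
      (fun s : ℝ => s ^ N)) {k : ℕ} (hk : k ≤ N) :
    iteratedDeriv k h 0 = k.factorial * c k := by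
  obtain ⟨u, hu, hhu⟩ := hh.contDiffOn le_rfl (by simp)
  obtain ⟨ε, hε, hball⟩ := Metric.mem_nhds_iff.1 hu
  have hcd : ContDiffOn ℝ N h (Metric.ball 0 ε) := hhu.mono hball
  have h0 : (0 : ℝ) ∈ Metric.ball (0 : ℝ) ε := Metric.mem_ball_self hε
  have ht := taylor_isLittleO (convex_ball (0 : ℝ) ε) h0 hcd
  rw [Metric.isOpen_ball.nhdsWithin_eq h0] at ht
  simp only [sub_zero, taylor_within_apply] at ht
  have hd := (hc.sub ht).mono (nhdsWithin_le_nhds (s := {0}ᶜ))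
  have hz := polynomial_coeff_eq_zero_of_isLittleO N
    (fun k => (k.factorial : ℝ)⁻¹ * iteratedDeriv k h 0 - c k) (hd.congr_left fun s => by
      have h1 : ∀ k ∈ Finset.range (N + 1),
          (((k.factorial : ℝ)⁻¹ * s ^ k) • iteratedDerivWithin k h (Metric.ball 0 ε) 0)
          = (k.factorial : ℝ)⁻¹ * iteratedDeriv k h 0 * s ^ k := fun k _ => by
        rw [iteratedDerivWithin_of_isOpen Metric.isOpen_ball h0, smul_eq_mul]; ring
      rw [Finset.sum_congr rfl h1]
      simp only [sub_mul, Finset.sum_sub_distrib]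
      ring) k hk
  have hf : (k.factorial : ℝ) ≠ 0 := by positivity
  field_simp at hz
  linarith

/-- The first, third and fifth derivative at `x₀` from a Taylor expansion of order five. -/
theorem derivs_of_expansion {f : ℝ → ℝ} {x₀ c₁ c₃ c₄ c₅ : ℝ} (hf : ContDiffAt ℝ ∞ f x₀)
    (h : (fun s : ℝ => f (x₀ + s) - (c₁ * s + c₃ * s ^ 3 + c₄ * s ^ 4 + c₅ * s ^ 5)) =o[𝓝 0]
      (fun s : ℝ => s ^ 5)) :
    deriv f x₀ = c₁ ∧ iteratedDeriv 3 f x₀ = 6 * c₃ ∧ iteratedDeriv 5 f x₀ = 120 * c₅ := by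
  have hf' : ContDiffAt ℝ (5 : ℕ) (fun s => f (x₀ + s)) 0 := by
    have : ContDiffAt ℝ (5 : ℕ) f (x₀ + 0) := by
      rw [add_zero]; exact hf.of_le (natCast_le_infty 5)
    exact this.comp (0 : ℝ) (f := fun s : ℝ => x₀ + s) (by fun_prop)
  let c : ℕ → ℝ := fun k => if k = 1 then c₁ else if k = 3 then c₃ else if k = 4 then c₄
    else if k = 5 then c₅ else 0
  have key : ∀ k ≤ 5, iteratedDeriv k f x₀ = k.factorial * c k := fun k hk => by
    have := iteratedDeriv_eq_of_isLittleO hf' (c := c) (h.congr_left fun s => by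
      simp [Finset.sum_range_succ, c]) hk
    rw [iteratedDeriv_comp_const_add] at this
    simpa using this
  refine ⟨?_, ?_, ?_⟩
  · simpa [c] using key 1 (by norm_num)
  · simpa [c, Nat.factorial] using key 3 (by norm_num)
  · simpa [c, Nat.factorial] using key 5 (by norm_num)

/-! ### Constancy along segments and rigidity of integer powers. -/

/-- A function on an open convex set is invariant under displacements annihilated by its
differential. -/
theorem eq_of_fderiv_displacement {E F : Type*} [NormedAddCommGroup E] [NormedSpace ℝ E]
    [NormedAddCommGroup F] [NormedSpace ℝ F] {Ω : Set E} (hconv : Convex ℝ Ω) {f : E → F}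
    (hf : ∀ z ∈ Ω, DifferentiableAt ℝ f z) {z z' : E} (hz : z ∈ Ω) (hz' : z' ∈ Ω)
    (h : ∀ y ∈ Ω, fderiv ℝ f y (z' - z) = 0) : f z' = f z := by
  have hmem : ∀ r ∈ Icc (0 : ℝ) 1, z + r • (z' - z) ∈ Ω := fun r hr =>
    hconv.add_smul_sub_mem hz hz' hr
  have hd : ∀ r ∈ Icc (0 : ℝ) 1, HasDerivWithinAt (fun r : ℝ => f (z + r • (z' - z))) 0
      (Icc 0 1) r := fun r hr => by
    have h1 : HasDerivAt (fun r : ℝ => z + r • (z' - z)) (z' - z) r := by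
      simpa using ((hasDerivAt_id r).smul_const (z' - z)).const_add z
    have h2 := (hf _ (hmem r hr)).hasFDerivAt.comp_hasDerivAt r h1
    rw [h _ (hmem r hr)] at h2
    exact h2.hasDerivWithinAt
  have := constant_of_has_deriv_right_zero (a := (0 : ℝ)) (b := 1)
    (f := fun r : ℝ => f (z + r • (z' - z)))
    (fun r hr => (hd r hr).continuousWithinAt)
    (fun r hr => ((hd r (Ico_subset_Icc_self hr)).mono_of_mem_nhdsWithin
      (Icc_mem_nhdsGE_of_mem hr))) 1 (by simp)
  simpa using this

/-- If two nontrivial integer powers agree up to affine substitutions on an open set, their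
exponents agree and the inner substitution is homogeneous unless the exponent is one. -/
theorem zpow_affine_rigidity {I : Set ℝ} (hI : IsOpen I) (hne : I.Nonempty)
    {C a D δ ε : ℝ} {m n : ℤ} (ha : a ≠ 0) (hδ : δ ≠ 0) (hn : n ≠ 0)
    (h0 : ∀ u ∈ I, u ≠ 0)
    (h : ∀ u ∈ I, C * (δ * u + ε) ^ m = a * u ^ n + D) :
    m = n ∧ C * δ ^ n = a ∧ (n ≠ 1 → ε = 0 ∧ D = 0) ∧ (n = 1 → D = C * ε) := by
  -- The exponents may be negative, so the identity is differentiated only where both bases are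
  -- nonzero.
  let J : Set ℝ := I ∩ {u | δ * u + ε ≠ 0}
  have hJ : IsOpen J := hI.inter (isOpen_ne_fun (by fun_prop) (by fun_prop))
  have hJ0 : ∀ u ∈ J, u ≠ 0 := fun u hu => h0 u hu.1
  have hinf : ∀ u ∈ I, (J ∩ {u}ᶜ).Nonempty := fun u hu => by
    have h1 : (I \ ({u, -ε / δ} : Set ℝ)).Nonempty :=
      ((infinite_of_mem_nhds u (hI.mem_nhds hu)).sdiff (by simp)).nonempty
    obtain ⟨w, hw, hw'⟩ := h1
    simp only [mem_insert_iff, mem_singleton_iff, not_or] at hw'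
    refine ⟨w, ⟨hw, fun h2 => hw'.2 ?_⟩, hw'.1⟩
    field_simp; linarith
  have hd1 : ∀ u ∈ J, C * (m * (δ * u + ε) ^ (m - 1) * δ) = a * (n * u ^ (n - 1)) := by
    intro u hu
    have h1 : HasDerivAt (fun u => C * (δ * u + ε) ^ m) (C * (m * (δ * u + ε) ^ (m - 1) * δ)) u := by
      have h3 : HasDerivAt (fun u => δ * u + ε) δ u := by
        simpa using ((hasDerivAt_id u).const_mul δ).add_const ε
      exact ((hasDerivAt_zpow m _ (Or.inl hu.2)).comp u h3).const_mul C
    have h2 : HasDerivAt (fun u => a * u ^ n + D) (a * (n * u ^ (n - 1))) u :=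
      ((hasDerivAt_zpow n _ (Or.inl (hJ0 u hu))).const_mul a).add_const D
    exact h1.unique (h2.congr_of_eventuallyEq (by
      filter_upwards [hI.mem_nhds hu.1] with w hw using h w hw))
  have hd2 : ∀ u ∈ J, C * (m * ((m - 1 : ℤ) * (δ * u + ε) ^ (m - 1 - 1) * δ) * δ)
      = a * (n * ((n - 1 : ℤ) * u ^ (n - 1 - 1))) := by
    intro u hu
    have h1 : HasDerivAt (fun u => C * (m * (δ * u + ε) ^ (m - 1) * δ))
        (C * (m * ((m - 1 : ℤ) * (δ * u + ε) ^ (m - 1 - 1) * δ) * δ)) u := by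
      have h3 : HasDerivAt (fun u => δ * u + ε) δ u := by
        simpa using ((hasDerivAt_id u).const_mul δ).add_const ε
      exact ((((hasDerivAt_zpow (m - 1) _ (Or.inl hu.2)).comp u h3).const_mul (m : ℝ)).mul_const
        δ).const_mul C
    have h2 : HasDerivAt (fun u => a * (n * u ^ (n - 1)))
        (a * (n * ((n - 1 : ℤ) * u ^ (n - 1 - 1)))) u :=
      ((hasDerivAt_zpow (n - 1) _ (Or.inl (hJ0 u hu))).const_mul (n : ℝ)).const_mul a
    exact h1.unique (h2.congr_of_eventuallyEq (by
      filter_upwards [hJ.mem_nhds hu] with w hw using hd1 w hw))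
  -- Comparing logarithmic derivatives of the two sides of `hd1` removes both powers. The resulting
  -- identity is affine in `u`: two points give `m = n`, and then the constant term gives `(m - 1) ε
  -- = 0`.
  have hlin : ∀ u ∈ J, (m - 1) * (δ * u) = (n - 1 : ℝ) * (δ * u + ε) := by
    intro u hu
    have e1 := hd1 u hu
    have e2 := hd2 u hu
    have hu0 := hJ0 u hu
    have hy : δ * u + ε ≠ 0 := hu.2
    rw [zpow_sub_one₀ hy (m - 1), zpow_sub_one₀ hu0 (n - 1)] at e2
    have hP : a * (n * u ^ (n - 1)) ≠ 0 :=
      mul_ne_zero ha (mul_ne_zero (by exact_mod_cast hn) (zpow_ne_zero _ hu0))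
    set y := δ * u + ε with hydef
    set Y := y ^ (m - 1)
    set V := u ^ (n - 1)
    have e3 : (C * (m * Y * δ)) * ((m - 1) * (δ * u)) = (a * (n * V)) * ((n - 1) * y) := by
      push_cast at e2
      field_simp at e2
      linear_combination e2
    rw [e1] at e3
    exact mul_left_cancel₀ hP e3
  obtain ⟨u₀, hu₀⟩ := hne
  obtain ⟨u₁, hu₁, -⟩ := hinf u₀ hu₀
  obtain ⟨u₂, hu₂, h12⟩ := hinf u₁ hu₁.1
  have hmn : m = n := by
    have e1 := hlin u₁ hu₁
    have e2 := hlin u₂ hu₂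
    have : ((m : ℝ) - n) * (δ * (u₁ - u₂)) = 0 := by linear_combination e1 - e2
    rcases mul_eq_zero.1 this with h | h
    · exact_mod_cast sub_eq_zero.1 h
    · rcases mul_eq_zero.1 h with h | h
      · exact absurd h hδ
      · exact absurd (sub_eq_zero.1 h).symm h12
  subst hmn
  have hε : ((m : ℝ) - 1) * ε = 0 := by linear_combination -hlin u₁ hu₁
  have hm0 : (m : ℝ) ≠ 0 := by exact_mod_cast hn
  have hε' : m ≠ 1 → ε = 0 := fun hm => by
    rcases mul_eq_zero.1 hε with h | h
    · exact absurd (by exact_mod_cast sub_eq_zero.1 h) hm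
    · exact h
  have hC : C * δ ^ m = a := by
    have e1 := hd1 u₁ hu₁
    by_cases hm : m = 1
    · subst hm
      simpa using e1
    · rw [hε' hm, add_zero, mul_zpow] at e1
      have hu := zpow_ne_zero (m - 1) (hJ0 u₁ hu₁)
      have hδm : δ ^ m = δ ^ (m - 1) * δ := by rw [← zpow_add_one₀ hδ, sub_add_cancel]
      rw [hδm]
      refine mul_left_cancel₀ (mul_ne_zero hm0 hu) ?_
      linear_combination e1
  refine ⟨rfl, hC, fun hm => ⟨hε' hm, ?_⟩, fun hm => ?_⟩
  · have := h u₁ hu₁.1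
    rw [hε' hm, add_zero, mul_zpow] at this
    linear_combination u₁ ^ m * hC - this
  · have := h u₁ hu₁.1
    subst hm
    simp only [zpow_one] at this hC
    linear_combination u₁ * hC - this

/-! ### Transforms of graphs. -/

/-- The parameterization of the graph of `u` by the independent variables. -/
def graphMap (u : ℝ → ℝ → ℝ) (q : ℝ × ℝ) : ℝ × ℝ × ℝ := (q.1, q.2, u q.1 q.2)

theorem contDiffAt_graphMap {u : ℝ → ℝ → ℝ} {q : ℝ × ℝ}
    (hu : ContDiffAt ℝ ∞ (Function.uncurry u) q) : ContDiffAt ℝ ∞ (graphMap u) q :=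
  contDiffAt_fst.prodMk (contDiffAt_snd.prodMk hu)

theorem hasFDerivAt_graphMap {u : ℝ → ℝ → ℝ} {q : ℝ × ℝ}
    (hu : ContDiffAt ℝ ∞ (Function.uncurry u) q) :
    HasFDerivAt (graphMap u) ((ContinuousLinearMap.fst ℝ ℝ ℝ).prod
      ((ContinuousLinearMap.snd ℝ ℝ ℝ).prod (fderiv ℝ (Function.uncurry u) q))) q :=
  hasFDerivAt_fst.prodMk (hasFDerivAt_snd.prodMk (hu.differentiableAt (by simp)).hasFDerivAt)

/-- The components of `Φ` for `(t, x, u)` form a smooth local diffeomorphism at `z`. -/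
structure RegularAt (Φ : Transformation) (z : ℝ × ℝ × ℝ) : Prop where
  smooth_T : ContDiffAt ℝ ∞ Φ.T z
  smooth_X : ContDiffAt ℝ ∞ Φ.X z
  smooth_U : ContDiffAt ℝ ∞ Φ.U z
  injective : ∀ v, fderiv ℝ Φ.T z v = 0 → fderiv ℝ Φ.X z v = 0 → fderiv ℝ Φ.U z v = 0 → v = 0

theorem contDiffAt_alongGraph {Φ : Transformation} {u : ℝ → ℝ → ℝ} {q : ℝ × ℝ}
    (hΦ : RegularAt Φ (graphMap u q)) (hu : ContDiffAt ℝ ∞ (Function.uncurry u) q) :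
    ContDiffAt ℝ ∞ (Φ.alongGraph u) q :=
  (hΦ.smooth_T.comp q (contDiffAt_graphMap hu)).prodMk
    (hΦ.smooth_X.comp q (contDiffAt_graphMap hu))

theorem fderiv_alongGraph_apply {Φ : Transformation} {u : ℝ → ℝ → ℝ} {q : ℝ × ℝ}
    (hΦ : RegularAt Φ (graphMap u q)) (hu : ContDiffAt ℝ ∞ (Function.uncurry u) q) (v : ℝ × ℝ) :
    fderiv ℝ (Φ.alongGraph u) q v =
      (fderiv ℝ Φ.T (graphMap u q) (v.1, v.2, fderiv ℝ (Function.uncurry u) q v),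
        fderiv ℝ Φ.X (graphMap u q) (v.1, v.2, fderiv ℝ (Function.uncurry u) q v)) := by
  have h1 := (hΦ.smooth_T.differentiableAt (by simp)).hasFDerivAt.comp q (hasFDerivAt_graphMap hu)
  have h2 := (hΦ.smooth_X.differentiableAt (by simp)).hasFDerivAt.comp q (hasFDerivAt_graphMap hu)
  have h3 : HasFDerivAt (Φ.alongGraph u) _ q := h1.prodMk h2
  rw [h3.fderiv]; rfl

/-- A smooth map with bijective differential has a smooth local inverse. -/
theorem exists_local_inverse {F : ℝ × ℝ → ℝ × ℝ} {q : ℝ × ℝ} (hF : ContDiffAt ℝ ∞ F q)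
    (hbij : Function.Bijective (fderiv ℝ F q)) :
    ∃ g : ℝ × ℝ → ℝ × ℝ, ContDiffAt ℝ ∞ g (F q) ∧ g (F q) = q ∧
      (∀ᶠ p in 𝓝 q, g (F p) = p) ∧ ∀ᶠ y in 𝓝 (F q), F (g y) = y := by
  let e : (ℝ × ℝ) ≃L[ℝ] (ℝ × ℝ) :=
    (LinearEquiv.ofBijective (fderiv ℝ F q : (ℝ × ℝ) →ₗ[ℝ] (ℝ × ℝ)) hbij).toContinuousLinearEquiv
  have he : (e : (ℝ × ℝ) →L[ℝ] (ℝ × ℝ)) = fderiv ℝ F q := by ext <;> rfl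
  have hF' : HasFDerivAt F (e : (ℝ × ℝ) →L[ℝ] (ℝ × ℝ)) q := by
    rw [he]; exact (hF.differentiableAt (by simp)).hasFDerivAt
  have hs := hF.hasStrictFDerivAt' hF' (by simp)
  exact ⟨hF.localInverse hF' (by simp), hF.to_localInverse hF' (by simp),
    hF.localInverse_apply_image hF' (by simp), hs.eventually_left_inverse,
    hs.eventually_right_inverse⟩

/-- The transform is `U` along the graph, composed with a local inverse of the new independent
variables. -/
theorem exists_mapsGraphAt {Φ : Transformation} {u : ℝ → ℝ → ℝ} {t x : ℝ}
    (hΦ : RegularAt Φ (graphMap u (t, x))) (hu : ContDiffAt ℝ ∞ (Function.uncurry u) (t, x))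
    (hbij : Function.Bijective (fderiv ℝ (Φ.alongGraph u) (t, x))) :
    ∃ v : ℝ → ℝ → ℝ, ContDiffAt ℝ ∞ (Function.uncurry v) (Φ.alongGraph u (t, x)) ∧
      Φ.MapsGraphAt u v t x := by
  obtain ⟨g, hg, hg0, hgl, -⟩ := exists_local_inverse (contDiffAt_alongGraph hΦ hu) hbij
  refine ⟨fun a b => Φ.U (graphMap u (g (a, b))), ?_, hbij, ?_⟩
  · have h1 : ContDiffAt ℝ ∞ (fun p => Φ.U (graphMap u p)) (g (Φ.alongGraph u (t, x))) := by
      rw [hg0]; exact hΦ.smooth_U.comp _ (contDiffAt_graphMap hu)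
    exact h1.comp _ hg
  · filter_upwards [hgl] with q hq
    simp only [Prod.mk.eta, hq]; rfl

/-- The preimage of the line of constant new time, parameterized by the new space variable. Pulling
back along it turns expansions in `(t, x)` into Taylor expansions of the transform in its space
variable. -/
theorem exists_inverse_curve {F : ℝ × ℝ → ℝ × ℝ} {q : ℝ × ℝ} (hF : ContDiffAt ℝ ∞ F q)
    (hbij : Function.Bijective (fderiv ℝ F q)) :
    ∃ (g : ℝ → ℝ × ℝ) (η : ℝ × ℝ), g 0 = q ∧ HasDerivAt g η 0 ∧ fderiv ℝ F q η = (0, 1) ∧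
      ∀ᶠ s in 𝓝 0, F (g s) = ((F q).1, (F q).2 + s) := by
  obtain ⟨G, hG, hG0, -, hGr⟩ := exists_local_inverse hF hbij
  have hline : HasDerivAt (fun s : ℝ => ((F q).1, (F q).2 + s)) ((0, 1) : ℝ × ℝ) 0 :=
    (hasDerivAt_const 0 _).prodMk ((hasDerivAt_id (0 : ℝ)).const_add _)
  have hl0 : (fun s : ℝ => ((F q).1, (F q).2 + s)) 0 = F q := by simp
  have hGd : HasFDerivAt G (fderiv ℝ G (F q)) ((fun s : ℝ => ((F q).1, (F q).2 + s)) 0) := by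
    rw [hl0]; exact (hG.differentiableAt (by simp)).hasFDerivAt
  have hg : HasDerivAt (fun s : ℝ => G ((F q).1, (F q).2 + s)) (fderiv ℝ G (F q) (0, 1)) 0 :=
    hGd.comp_hasDerivAt 0 hline
  have hev : ∀ᶠ s in 𝓝 (0 : ℝ), F (G ((F q).1, (F q).2 + s)) = ((F q).1, (F q).2 + s) := by
    have : Tendsto (fun s : ℝ => ((F q).1, (F q).2 + s)) (𝓝 0) (𝓝 (F q)) := by
      have := hline.continuousAt.tendsto
      simp only [add_zero] at this
      exact this
    exact this.eventually hGr
  refine ⟨fun s => G ((F q).1, (F q).2 + s), _, by simp [hG0], hg, ?_, hev⟩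
  have hFd : HasFDerivAt F (fderiv ℝ F q) ((fun s : ℝ => G ((F q).1, (F q).2 + s)) 0) := by
    simp only [add_zero, Prod.mk.eta, hG0]
    exact (hF.differentiableAt (by simp)).hasFDerivAt
  exact ((hFd.comp_hasDerivAt 0 hg).congr_of_eventuallyEq
    (by filter_upwards [hev] with s hs using hs.symm)).unique hline

/-! ### The difference of two transforms. -/

/-- To first order, a variation of `u` changes the transformed function by a nonzero multiple of
the variation. -/
theorem variation_isLittleO {Φ : Transformation} {u w v v' : ℝ → ℝ → ℝ} {t x : ℝ}
    (hΦ : RegularAt Φ (graphMap u (t, x)))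
    (hu : ContDiffAt ℝ ∞ (Function.uncurry u) (t, x))
    (hw : ContDiffAt ℝ ∞ (Function.uncurry w) (t, x)) (huw : u t x = w t x)
    (hv : ContDiffAt ℝ ∞ (Function.uncurry v) (Φ.alongGraph u (t, x)))
    (hm : Φ.MapsGraphAt u v t x) (hm' : Φ.MapsGraphAt w v' t x) :
    ∃ c : ℝ, c ≠ 0 ∧
      (fderiv ℝ Φ.T (graphMap u (t, x)) (0, 0, 1) = 0 →
        fderiv ℝ Φ.X (graphMap u (t, x)) (0, 0, 1) = 0 →
        c = fderiv ℝ Φ.U (graphMap u (t, x)) (0, 0, 1)) ∧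
      (fun q : ℝ × ℝ => v' (Φ.alongGraph w q).1 (Φ.alongGraph w q).2
          - v (Φ.alongGraph w q).1 (Φ.alongGraph w q).2 - c * (w q.1 q.2 - u q.1 q.2))
        =o[𝓝 (t, x)] (fun q : ℝ × ℝ => w q.1 q.2 - u q.1 q.2) := by
  let z := graphMap u (t, x)
  have hzw : graphMap w (t, x) = z := by simp [z, graphMap, huw]
  -- `G` vanishes on the graph of `u`, and on the graph of `w` it equals `v' - v` at the new
  -- variables. Its derivative in the `u`-direction is therefore the required factor `c`.
  let G : ℝ × ℝ × ℝ → ℝ := fun p => Φ.U p - Function.uncurry v (Φ.T p, Φ.X p)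
  have hTX : ContDiffAt ℝ ∞ (fun p => (Φ.T p, Φ.X p)) z := hΦ.smooth_T.prodMk hΦ.smooth_X
  have hG : ContDiffAt ℝ ∞ G z := hΦ.smooth_U.sub
    (ContDiffAt.comp (g := Function.uncurry v) z hv hTX)
  have hGs := hG.hasStrictFDerivAt (by simp)
  have hGf : ∀ p, fderiv ℝ G z p = fderiv ℝ Φ.U z p -
      fderiv ℝ (Function.uncurry v) (Φ.T z, Φ.X z) (fderiv ℝ Φ.T z p, fderiv ℝ Φ.X z p) := by
    intro p
    have h1 := (hΦ.smooth_T.differentiableAt (by simp)).hasFDerivAt.prodMk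
      (hΦ.smooth_X.differentiableAt (by simp)).hasFDerivAt
    have hvd : HasFDerivAt (Function.uncurry v) (fderiv ℝ (Function.uncurry v) (Φ.T z, Φ.X z))
      (Φ.T z, Φ.X z) := (hv.differentiableAt (by simp)).hasFDerivAt
    have h2 := (hΦ.smooth_U.differentiableAt (by simp)).hasFDerivAt.sub
      (HasFDerivAt.comp z hvd h1)
    have h3 : HasFDerivAt G _ z := h2
    rw [h3.fderiv]; rfl
  have hG0 : ∀ᶠ q in 𝓝 (t, x), G (graphMap u q) = 0 := by
    filter_upwards [hm.2] with q hq
    exact sub_eq_zero.2 hq.symm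
  have hGu : ∀ p : ℝ × ℝ, fderiv ℝ G z (p.1, p.2, fderiv ℝ (Function.uncurry u) (t, x) p) = 0 := by
    intro p
    have h1 := (hG.differentiableAt (by simp)).hasFDerivAt.comp (t, x) (hasFDerivAt_graphMap hu)
    have h2 : HasFDerivAt (fun q => G (graphMap u q)) (0 : ℝ × ℝ →L[ℝ] ℝ) (t, x) :=
      (hasFDerivAt_const (0 : ℝ) (t, x)).congr_of_eventuallyEq hG0
    have h3 := h1.unique h2
    exact DFunLike.congr_fun h3 p
  refine ⟨fderiv ℝ G z (0, 0, 1), ?_, ?_, ?_⟩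
  -- The differential of `G` kills the tangent plane of the graph; if it also kills the vertical
  -- direction, it is zero. By dimension some nonzero vector is annihilated by `dT` and `dX`, and
  -- then also by `dU`, contradicting regularity.
  · intro h0
    have hall : ∀ p, fderiv ℝ G z p = 0 := by
      rintro ⟨a, b, e⟩
      have h1 := hGu (a, b)
      have h2 : ((a, b, e) : ℝ × ℝ × ℝ) = (a, b, fderiv ℝ (Function.uncurry u) (t, x) (a, b))
          + (e - fderiv ℝ (Function.uncurry u) (t, x) (a, b)) • ((0, 0, 1) : ℝ × ℝ × ℝ) := by
        simp
      rw [h2, map_add, map_smul, h0]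
      simpa using h1
    have hni : ¬ Function.Injective
        ((fderiv ℝ Φ.T z).prod (fderiv ℝ Φ.X z) : ℝ × ℝ × ℝ →ₗ[ℝ] ℝ × ℝ) := by
      intro hinj
      have := LinearMap.finrank_le_finrank_of_injective hinj
      simp at this
    apply hni
    rw [← LinearMap.ker_eq_bot, LinearMap.ker_eq_bot']
    intro p hp
    have hp' : (fderiv ℝ Φ.T z p, fderiv ℝ Φ.X z p) = ((0, 0) : ℝ × ℝ) := hp
    obtain ⟨hp1, hp2⟩ := Prod.mk.inj hp'
    refine hΦ.injective p hp1 hp2 ?_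
    have := hGf p
    rw [hall p, hp1, hp2, Prod.mk_zero_zero, map_zero, sub_zero] at this
    exact this.symm
  · intro hT hX
    rw [hGf]
    rw [show fderiv ℝ Φ.T z (0, 0, 1) = 0 from hT, show fderiv ℝ Φ.X z (0, 0, 1) = 0 from hX]
    rw [Prod.mk_zero_zero, map_zero, sub_zero]
  · have hcont : Tendsto (fun q => (graphMap w q, graphMap u q)) (𝓝 (t, x)) (𝓝 (z, z)) := by
      have h1 := (contDiffAt_graphMap hw).continuousAt.tendsto
      rw [hzw] at h1
      have h2 : Tendsto (graphMap u) (𝓝 (t, x)) (𝓝 z) :=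
        (contDiffAt_graphMap hu).continuousAt.tendsto
      exact h1.prodMk_nhds h2
    -- Strict differentiability is essential: both points, on the graphs of `w` and `u`, move with
    -- `q`, and the error must be small relative to their vertical distance.
    have h1 := hGs.isLittleO.comp_tendsto hcont
    have hsub : ∀ q, graphMap w q - graphMap u q
        = (w q.1 q.2 - u q.1 q.2) • ((0, 0, 1) : ℝ × ℝ × ℝ) := fun q => by simp [graphMap]
    have hO : (fun q => graphMap w q - graphMap u q) =O[𝓝 (t, x)]
        (fun q : ℝ × ℝ => w q.1 q.2 - u q.1 q.2) := by
      refine Asymptotics.IsBigO.of_bound ‖((0, 0, 1) : ℝ × ℝ × ℝ)‖ (Eventually.of_forall fun q => ?_)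
      rw [hsub, norm_smul, mul_comm]
    refine (h1.congr' (f₂ := fun q : ℝ × ℝ => v' (Φ.alongGraph w q).1 (Φ.alongGraph w q).2
          - v (Φ.alongGraph w q).1 (Φ.alongGraph w q).2
          - fderiv ℝ G z (0, 0, 1) * (w q.1 q.2 - u q.1 q.2)) ?_ EventuallyEq.rfl).trans_isBigO hO
    filter_upwards [hG0, hm'.2] with q hq hq'
    simp only [Function.comp_apply, hq, hsub, map_smul, smul_eq_mul]
    have : G (graphMap w q) = v' (Φ.alongGraph w q).1 (Φ.alongGraph w q).2
        - v (Φ.alongGraph w q).1 (Φ.alongGraph w q).2 := by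
      rw [hq']; rfl
    rw [this]; ring

theorem deriv_fst_eq_fderiv {v : ℝ → ℝ → ℝ} {a b : ℝ}
    (hv : DifferentiableAt ℝ (Function.uncurry v) (a, b)) :
    deriv (fun r => v r b) a = fderiv ℝ (Function.uncurry v) (a, b) (1, 0) := by
  have h1 : HasDerivAt (fun r : ℝ => (r, b)) ((1, 0) : ℝ × ℝ) a :=
    (hasDerivAt_id a).prodMk (hasDerivAt_const a b)
  exact (hv.hasFDerivAt.comp_hasDerivAt a h1).deriv

theorem deriv_snd_eq_fderiv {v : ℝ → ℝ → ℝ} {a b : ℝ}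
    (hv : DifferentiableAt ℝ (Function.uncurry v) (a, b)) :
    deriv (v a) b = fderiv ℝ (Function.uncurry v) (a, b) (0, 1) := by
  have h1 : HasDerivAt (fun r : ℝ => (a, r)) ((0, 1) : ℝ × ℝ) b :=
    (hasDerivAt_const b a).prodMk (hasDerivAt_id b)
  exact (hv.hasFDerivAt.comp_hasDerivAt b h1).deriv

theorem contDiffAt_slice {v : ℝ → ℝ → ℝ} {a b : ℝ}
    (hv : ContDiffAt ℝ ∞ (Function.uncurry v) (a, b)) : ContDiffAt ℝ ∞ (v a) b :=
  ContDiffAt.comp (g := Function.uncurry v) (f := fun r : ℝ => (a, r)) b hv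
    (contDiffAt_const.prodMk contDiffAt_id)

/-- The difference `d` of the transforms of two functions `u` and `w` with a common value at
`(t, x)`: its expansion at the image point and the linear equation that it satisfies there if both
functions satisfy an equation that is mapped to an equation of the class. -/
theorem exists_variation {Φ : Transformation} {u w : ℝ → ℝ → ℝ} {t x : ℝ}
    (hΦ : RegularAt Φ (graphMap u (t, x)))
    (hu : ContDiffAt ℝ ∞ (Function.uncurry u) (t, x))
    (hw : ContDiffAt ℝ ∞ (Function.uncurry w) (t, x)) (huw : u t x = w t x)
    (hbu : Function.Bijective (fderiv ℝ (Φ.alongGraph u) (t, x)))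
    (hbw : Function.Bijective (fderiv ℝ (Φ.alongGraph w) (t, x))) :
    ∃ (d : ℝ → ℝ → ℝ) (c : ℝ) (g : ℝ → ℝ × ℝ) (η : ℝ × ℝ),
      ContDiffAt ℝ ∞ (Function.uncurry d) (Φ.alongGraph w (t, x)) ∧ c ≠ 0 ∧
      (fderiv ℝ Φ.T (graphMap u (t, x)) (0, 0, 1) = 0 →
        fderiv ℝ Φ.X (graphMap u (t, x)) (0, 0, 1) = 0 →
        c = fderiv ℝ Φ.U (graphMap u (t, x)) (0, 0, 1)) ∧
      g 0 = (t, x) ∧ HasDerivAt g η 0 ∧ fderiv ℝ (Φ.alongGraph w) (t, x) η = (0, 1) ∧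
      (∀ᶠ s in 𝓝 0, Φ.alongGraph w (g s) =
        ((Φ.alongGraph w (t, x)).1, (Φ.alongGraph w (t, x)).2 + s)) ∧
      (fun s => d (Φ.alongGraph w (t, x)).1 ((Φ.alongGraph w (t, x)).2 + s)
          - c * (w (g s).1 (g s).2 - u (g s).1 (g s).2))
        =o[𝓝 0] (fun s => w (g s).1 (g s).2 - u (g s).1 (g s).2) ∧
      (∀ p, fderiv ℝ (Function.uncurry d) (Φ.alongGraph w (t, x))
          (fderiv ℝ (Φ.alongGraph w) (t, x) p)
        = c * (fderiv ℝ (Function.uncurry w) (t, x) p - fderiv ℝ (Function.uncurry u) (t, x) p)) ∧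
      ((∀ᶠ q in 𝓝 (t, x), Φ.alongGraph u q = Φ.alongGraph w q) → ∀ᶠ s in 𝓝 0,
        d (Φ.alongGraph w (t, x)).1 ((Φ.alongGraph w (t, x)).2 + s)
          = Φ.U (graphMap w (g s)) - Φ.U (graphMap u (g s))) ∧
      ∀ (Ω : Set (ℝ × ℝ × ℝ)) (θ θ' : Elements), graphMap u (t, x) ∈ Ω →
        Φ.MapsEquation Ω θ θ' → SatisfiesAt θ u t x → SatisfiesAt θ w t x →
        fderiv ℝ (Function.uncurry d) (Φ.alongGraph w (t, x)) (1, 0)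
          + θ'.α (Φ.T (graphMap u (t, x))) * Φ.U (graphMap u (t, x)) ^ θ'.n
            * deriv (d (Φ.alongGraph w (t, x)).1) (Φ.alongGraph w (t, x)).2
          + θ'.β (Φ.T (graphMap u (t, x)))
            * iteratedDeriv 3 (d (Φ.alongGraph w (t, x)).1) (Φ.alongGraph w (t, x)).2
          + θ'.σ (Φ.T (graphMap u (t, x)))
            * iteratedDeriv 5 (d (Φ.alongGraph w (t, x)).1) (Φ.alongGraph w (t, x)).2 = 0 := by
  have hz : graphMap w (t, x) = graphMap u (t, x) := by simp [graphMap, huw]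
  have hΦw : RegularAt Φ (graphMap w (t, x)) := by rw [hz]; exact hΦ
  have hζ : Φ.alongGraph u (t, x) = Φ.alongGraph w (t, x) := by
    simp [Transformation.alongGraph, huw]
  obtain ⟨v, hv, hm⟩ := exists_mapsGraphAt hΦ hu hbu
  obtain ⟨v', hv', hm'⟩ := exists_mapsGraphAt hΦw hw hbw
  have hF := contDiffAt_alongGraph hΦw hw
  obtain ⟨g, η, hg0, hg, hη, hFg⟩ := exists_inverse_curve hF hbw
  obtain ⟨c, hc, hcU, hvar⟩ := variation_isLittleO hΦ hu hw huw hv hm hm'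
  have hgt : Tendsto g (𝓝 0) (𝓝 (t, x)) := by
    have := hg.continuousAt.tendsto
    rwa [hg0] at this
  have hvw : ContDiffAt ℝ ∞ (Function.uncurry v) (Φ.alongGraph w (t, x)) := by rwa [← hζ]
  set ζ := Φ.alongGraph w (t, x) with hζdef
  have hd : ContDiffAt ℝ ∞ (Function.uncurry fun a b => v' a b - v a b) ζ := hv'.sub hvw
  have hud := (hu.differentiableAt (by simp)).hasFDerivAt
  have hwd := (hw.differentiableAt (by simp)).hasFDerivAt
  refine ⟨fun a b => v' a b - v a b, c, g, η, hd, hc, hcU, hg0, hg, hη, hFg, ?_, ?_, ?_, ?_⟩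
  · refine (hvar.comp_tendsto hgt).congr' ?_ EventuallyEq.rfl
    filter_upwards [hFg] with s hs
    simp only [Function.comp_apply, hs]
  · intro p
    have h1 : HasFDerivAt (fun q : ℝ × ℝ => w q.1 q.2 - u q.1 q.2)
        (fderiv ℝ (Function.uncurry w) (t, x) - fderiv ℝ (Function.uncurry u) (t, x)) (t, x) :=
      hwd.sub hud
    have hO : (fun q : ℝ × ℝ => w q.1 q.2 - u q.1 q.2) =O[𝓝 (t, x)] fun q => q - (t, x) := by
      simpa [huw] using h1.isBigO_sub
    have h2 := hvar.trans_isBigO hO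
    have h3 : HasFDerivAt (fun q : ℝ × ℝ => v' (Φ.alongGraph w q).1 (Φ.alongGraph w q).2
        - v (Φ.alongGraph w q).1 (Φ.alongGraph w q).2 - c * (w q.1 q.2 - u q.1 q.2))
        (0 : ℝ × ℝ →L[ℝ] ℝ) (t, x) := by
      refine HasFDerivAt.of_isLittleO ?_
      have h0 : v' ζ.1 ζ.2 - v ζ.1 ζ.2 = 0 := by
        have e1 := hm.2.self_of_nhds
        have e2 := hm'.2.self_of_nhds
        rw [hζ] at e1
        simp only [← hζdef] at e1 e2
        rw [e1, e2, huw, sub_self]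
      refine h2.congr_left fun q => ?_
      simp only [huw, sub_self, mul_zero, zero_apply, sub_zero]
      rw [← hζdef, h0, sub_zero]
    have hdd : HasFDerivAt (Function.uncurry fun a b => v' a b - v a b)
        (fderiv ℝ (Function.uncurry fun a b => v' a b - v a b) ζ) (Φ.alongGraph w (t, x)) :=
      (hd.differentiableAt (by simp)).hasFDerivAt
    have h4 := hdd.comp (t, x) (hF.differentiableAt (by simp)).hasFDerivAt
    have h5 := (h4.sub (h1.const_mul c)).unique h3
    have h6 := DFunLike.congr_fun h5 p
    simp only [sub_apply, ContinuousLinearMap.comp_apply,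
      smul_apply, zero_apply, smul_eq_mul] at h6
    linarith
  · intro hFF
    filter_upwards [hFg, hgt.eventually hFF, hgt.eventually hm.2, hgt.eventually hm'.2]
      with s h1 h2 h3 h4
    rw [h2] at h3
    rw [h1] at h3 h4
    simp only [h3, h4]
    rfl
  -- The two target equations have the same factor `U ^ n'`, so subtracting them gives a linear
  -- relation for the difference.
  · intro Ω θ θ' hΩ hmap hsu hsw
    have h1 := (hmap u v t x hΩ hu hv hm).1 hsu
    have h2 := (hmap w v' t x (by rw [← huw]; exact hΩ) hw hv' hm').1 hsw
    rw [hζ] at h1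
    have e1 : v ζ.1 ζ.2 = Φ.U (graphMap u (t, x)) := by
      have := hm.2.self_of_nhds
      rw [hζ] at this
      exact this
    have e2 : v' ζ.1 ζ.2 = Φ.U (graphMap u (t, x)) := by
      rw [← hz]; exact hm'.2.self_of_nhds
    have e3 : ζ.1 = Φ.T (graphMap u (t, x)) := by rw [← hz]; rfl
    have h1' := h1.2
    have h2' := h2.2
    have hvs := contDiffAt_slice (a := ζ.1) (b := ζ.2) hvw
    have hvs' := contDiffAt_slice (a := ζ.1) (b := ζ.2) hv'
    rw [← hζdef] at h2'
    rw [e1, deriv_fst_eq_fderiv (a := ζ.1) (b := ζ.2) (hvw.differentiableAt (by simp))] at h1'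
    rw [e2, deriv_fst_eq_fderiv (a := ζ.1) (b := ζ.2) (hv'.differentiableAt (by simp))] at h2'
    have hfd : fderiv ℝ (Function.uncurry fun a b => v' a b - v a b) ζ (1, 0)
        = fderiv ℝ (Function.uncurry v') ζ (1, 0) - fderiv ℝ (Function.uncurry v) ζ (1, 0) := by
      have h3 := (hv'.differentiableAt (by simp)).hasFDerivAt.sub
        (hvw.differentiableAt (by simp)).hasFDerivAt
      have h4 : HasFDerivAt (Function.uncurry fun a b => v' a b - v a b) _ ζ := h3
      rw [h4.fderiv]; rfl
    have hit : ∀ k : ℕ, iteratedDeriv k (fun b => v' ζ.1 b - v ζ.1 b) ζ.2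
        = iteratedDeriv k (v' ζ.1) ζ.2 - iteratedDeriv k (v ζ.1) ζ.2 := fun k =>
      iteratedDeriv_sub (hvs'.of_le (natCast_le_infty k)) (hvs.of_le (natCast_le_infty k))
    have hit1 := hit 1
    simp only [iteratedDeriv_one] at hit1
    rw [hfd, hit1, hit 3, hit 5, ← e3]
    simp only [Prod.mk.eta] at h1' h2'
    linear_combination h2' - h1'

/-! ### Polynomial test functions. -/

/-- A polynomial function with prescribed value and selected Taylor coefficients at a point. -/
def jetPoly (t₀ x₀ u₀ p m q r l e : ℝ) (t x : ℝ) : ℝ :=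
  u₀ + p * (t - t₀) + m * (t - t₀) ^ 5 +
    (q * (x - x₀) + r * (x - x₀) ^ 3 + l * (x - x₀) ^ 4 + e * (x - x₀) ^ 5)

section jetPoly

variable (t₀ x₀ u₀ p m q r l e : ℝ)

theorem contDiff_jetPoly : ContDiff ℝ ∞ (Function.uncurry (jetPoly t₀ x₀ u₀ p m q r l e)) := by
  unfold jetPoly Function.uncurry
  fun_prop

@[simp]
theorem jetPoly_self : jetPoly t₀ x₀ u₀ p m q r l e t₀ x₀ = u₀ := by simp [jetPoly]

@[simp]
theorem graphMap_jetPoly :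
    graphMap (jetPoly t₀ x₀ u₀ p m q r l e) (t₀, x₀) = (t₀, x₀, u₀) := by simp [graphMap]

theorem deriv_jetPoly_fst :
    deriv (fun s => jetPoly t₀ x₀ u₀ p m q r l e s x₀) t₀ = p := by
  -- The expansion criterion admits no constant term, so `u₀` is split off and replaced by `0`.
  have h := (derivs_of_expansion (f := fun s => jetPoly t₀ x₀ 0 p m q r l e s x₀) (x₀ := t₀)
    (c₁ := p) (c₃ := 0) (c₄ := 0) (c₅ := m)
    (by unfold jetPoly; fun_prop) (by simp [jetPoly])).1
  have h2 : (fun s => jetPoly t₀ x₀ u₀ p m q r l e s x₀)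
      = fun s => u₀ + jetPoly t₀ x₀ 0 p m q r l e s x₀ := by
    funext s; simp only [jetPoly]; ring
  rw [h2, deriv_const_add]
  exact h

theorem derivs_jetPoly_snd :
    deriv (jetPoly t₀ x₀ u₀ p m q r l e t₀) x₀ = q ∧
    iteratedDeriv 3 (jetPoly t₀ x₀ u₀ p m q r l e t₀) x₀ = 6 * r ∧
    iteratedDeriv 5 (jetPoly t₀ x₀ u₀ p m q r l e t₀) x₀ = 120 * e := by
  have h := derivs_of_expansion (f := jetPoly t₀ x₀ 0 p m q r l e t₀) (x₀ := x₀)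
    (c₁ := q) (c₃ := r) (c₄ := l) (c₅ := e)
    (by unfold jetPoly; fun_prop) (by simp [jetPoly])
  have h2 : jetPoly t₀ x₀ u₀ p m q r l e t₀
      = fun s => u₀ + jetPoly t₀ x₀ 0 p m q r l e t₀ s := by
    funext s; simp only [jetPoly]; ring
  rw [h2, deriv_const_add, iteratedDeriv_const_add (by norm_num),
    iteratedDeriv_const_add (by norm_num)]
  exact h

theorem fderiv_jetPoly (v : ℝ × ℝ) :
    fderiv ℝ (Function.uncurry (jetPoly t₀ x₀ u₀ p m q r l e)) (t₀, x₀) v = p * v.1 + q * v.2 := by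
  have hd : DifferentiableAt ℝ (Function.uncurry (jetPoly t₀ x₀ u₀ p m q r l e)) (t₀, x₀) :=
    (contDiff_jetPoly t₀ x₀ u₀ p m q r l e).differentiable (by simp) _
  have h1 := deriv_fst_eq_fderiv hd
  have h2 := deriv_snd_eq_fderiv hd
  rw [deriv_jetPoly_fst] at h1
  rw [(derivs_jetPoly_snd t₀ x₀ u₀ p m q r l e).1] at h2
  have hv : v = v.1 • ((1, 0) : ℝ × ℝ) + v.2 • ((0, 1) : ℝ × ℝ) := by ext <;> simp
  rw [hv, map_add, map_smul, map_smul, ← h1, ← h2]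
  simp; ring

variable {u₀} in
theorem satisfiesAt_jetPoly (hu₀ : u₀ ≠ 0) {a b s : ℝ} {n : ℤ}
    (h : p + a * u₀ ^ n * q + 6 * b * r + 120 * s * e = 0) :
    SatisfiesAt ⟨fun _ => a, fun _ => b, fun _ => s, n⟩ (jetPoly t₀ x₀ u₀ p m q r l e) t₀ x₀ := by
  refine ⟨fun _ => by simpa using hu₀, ?_⟩
  obtain ⟨h1, h2, h3⟩ := derivs_jetPoly_snd t₀ x₀ u₀ p m q r l e
  simp only [deriv_jetPoly_fst, h1, h2, h3, jetPoly_self]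
  linear_combination h

end jetPoly

theorem map_triple (L : ℝ × ℝ × ℝ →L[ℝ] ℝ) (a b c : ℝ) :
    L (a, b, c) = a * L (1, 0, 0) + b * L (0, 1, 0) + c * L (0, 0, 1) := by
  have : ((a, b, c) : ℝ × ℝ × ℝ) = a • ((1, 0, 0) : ℝ × ℝ × ℝ) + b • ((0, 1, 0) : ℝ × ℝ × ℝ)
      + c • ((0, 0, 1) : ℝ × ℝ × ℝ) := by simp
  rw [this]; simp only [map_add, map_smul, smul_eq_mul]

theorem fderiv_alongGraph_jetPoly {Φ : Transformation} {t x u₀ : ℝ}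
    (hΦ : RegularAt Φ (t, x, u₀)) (p m q r l e : ℝ) (v : ℝ × ℝ) :
    fderiv ℝ (Φ.alongGraph (jetPoly t x u₀ p m q r l e)) (t, x) v =
      (fderiv ℝ Φ.T (t, x, u₀) (v.1, v.2, p * v.1 + q * v.2),
        fderiv ℝ Φ.X (t, x, u₀) (v.1, v.2, p * v.1 + q * v.2)) := by
  rw [fderiv_alongGraph_apply (by simpa using hΦ) (contDiff_jetPoly ..).contDiffAt,
    fderiv_jetPoly, graphMap_jetPoly]

/-- The assumed nonzero quantity is the determinant of total derivatives `D_t T · D_x X - D_x T ·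
D_t X`, with `u_t = p` and `u_x = q`. -/
theorem bijective_of_jacobian_ne_zero {Φ : Transformation} {t x u₀ : ℝ}
    (hΦ : RegularAt Φ (t, x, u₀)) {p m q r l e : ℝ}
    (hJ : (fderiv ℝ Φ.T (t, x, u₀) (1, 0, 0) + p * fderiv ℝ Φ.T (t, x, u₀) (0, 0, 1))
          * (fderiv ℝ Φ.X (t, x, u₀) (0, 1, 0) + q * fderiv ℝ Φ.X (t, x, u₀) (0, 0, 1))
        - (fderiv ℝ Φ.T (t, x, u₀) (0, 1, 0) + q * fderiv ℝ Φ.T (t, x, u₀) (0, 0, 1))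
          * (fderiv ℝ Φ.X (t, x, u₀) (1, 0, 0) + p * fderiv ℝ Φ.X (t, x, u₀) (0, 0, 1)) ≠ 0) :
    Function.Bijective (fderiv ℝ (Φ.alongGraph (jetPoly t x u₀ p m q r l e)) (t, x)) := by
  set L := fderiv ℝ (Φ.alongGraph (jetPoly t x u₀ p m q r l e)) (t, x) with hL
  have hinj : Function.Injective (L : ℝ × ℝ →ₗ[ℝ] ℝ × ℝ) := by
    rw [← LinearMap.ker_eq_bot, LinearMap.ker_eq_bot']
    rintro ⟨v, w⟩ h
    have h' : L (v, w) = (0, 0) := h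
    rw [hL, fderiv_alongGraph_jetPoly hΦ] at h'
    obtain ⟨h1, h2⟩ := Prod.mk.inj h'
    simp only at h1 h2
    rw [map_triple] at h1 h2
    have hv : v = 0 := by
      refine (mul_eq_zero.1 ?_).resolve_right hJ
      linear_combination (fderiv ℝ Φ.X (t, x, u₀) (0, 1, 0)
        + q * fderiv ℝ Φ.X (t, x, u₀) (0, 0, 1)) * h1 - (fderiv ℝ Φ.T (t, x, u₀) (0, 1, 0)
        + q * fderiv ℝ Φ.T (t, x, u₀) (0, 0, 1)) * h2
    have hw : w = 0 := by
      refine (mul_eq_zero.1 ?_).resolve_right hJ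
      linear_combination (fderiv ℝ Φ.T (t, x, u₀) (1, 0, 0)
        + p * fderiv ℝ Φ.T (t, x, u₀) (0, 0, 1)) * h2 - (fderiv ℝ Φ.X (t, x, u₀) (1, 0, 0)
        + p * fderiv ℝ Φ.X (t, x, u₀) (0, 0, 1)) * h1
    rw [hv, hw]; rfl
  exact ⟨hinj, LinearMap.injective_iff_surjective.1 hinj⟩

/-! ### The time component. -/

theorem exists_affine_ne_zero {a b c d : ℝ} (h : a ≠ 0 ∨ b ≠ 0) (h' : c ≠ 0 ∨ d ≠ 0) :
    ∃ q : ℝ, a + q * b ≠ 0 ∧ c + q * d ≠ 0 := by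
  obtain ⟨q, hq⟩ := Infinite.exists_notMem_finset ({-a / b, -c / d} : Finset ℝ)
  simp only [Finset.mem_insert, Finset.mem_singleton, not_or] at hq
  refine ⟨q, fun h0 => ?_, fun h0 => ?_⟩
  · by_cases hb : b = 0
    · simp_all
    · exact hq.1 (by field_simp; linarith)
  · by_cases hd : d = 0
    · simp_all
    · exact hq.2 (by field_simp; linarith)

/-- A generic first-order jet for which the new independent variables are coordinates and the new
time depends on `x` along the graph, unless the new time is a function of `t` only. -/
theorem exists_generic_jet {Φ : Transformation} {z : ℝ × ℝ × ℝ} (hΦ : RegularAt Φ z)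
    (hT : fderiv ℝ Φ.T z (0, 1, 0) ≠ 0 ∨ fderiv ℝ Φ.T z (0, 0, 1) ≠ 0) :
    ∃ p q : ℝ, fderiv ℝ Φ.T z (0, 1, 0) + q * fderiv ℝ Φ.T z (0, 0, 1) ≠ 0 ∧
      (fderiv ℝ Φ.T z (1, 0, 0) + p * fderiv ℝ Φ.T z (0, 0, 1))
          * (fderiv ℝ Φ.X z (0, 1, 0) + q * fderiv ℝ Φ.X z (0, 0, 1))
        - (fderiv ℝ Φ.T z (0, 1, 0) + q * fderiv ℝ Φ.T z (0, 0, 1))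
          * (fderiv ℝ Φ.X z (1, 0, 0) + p * fderiv ℝ Φ.X z (0, 0, 1)) ≠ 0 := by
  let L : ℝ × ℝ × ℝ →ₗ[ℝ] ℝ × ℝ × ℝ :=
    ((fderiv ℝ Φ.T z).prod ((fderiv ℝ Φ.X z).prod (fderiv ℝ Φ.U z)) :
      ℝ × ℝ × ℝ →L[ℝ] ℝ × ℝ × ℝ)
  have hinj : Function.Injective L := by
    rw [← LinearMap.ker_eq_bot, LinearMap.ker_eq_bot']
    intro v hv
    have hv' : (fderiv ℝ Φ.T z v, fderiv ℝ Φ.X z v, fderiv ℝ Φ.U z v) = (0, 0, 0) := hv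
    simp only [Prod.mk.injEq] at hv'
    exact hΦ.injective v hv'.1 hv'.2.1 hv'.2.2
  have hsurj := LinearMap.injective_iff_surjective.1 hinj
  obtain ⟨⟨v₁, v₂, v₃⟩, hv⟩ := hsurj (1, 0, 0)
  obtain ⟨⟨w₁, w₂, w₃⟩, hw⟩ := hsurj (0, 1, 0)
  have hv' : (fderiv ℝ Φ.T z (v₁, v₂, v₃), fderiv ℝ Φ.X z (v₁, v₂, v₃),
    fderiv ℝ Φ.U z (v₁, v₂, v₃)) = (1, 0, 0) := hv
  have hw' : (fderiv ℝ Φ.T z (w₁, w₂, w₃), fderiv ℝ Φ.X z (w₁, w₂, w₃),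
    fderiv ℝ Φ.U z (w₁, w₂, w₃)) = (0, 1, 0) := hw
  simp only [Prod.mk.injEq] at hv' hw'
  obtain ⟨hv1, hv2, -⟩ := hv'
  obtain ⟨hw1, hw2, -⟩ := hw'
  rw [map_triple] at hv1 hv2 hw1 hw2
  generalize fderiv ℝ Φ.T z (1, 0, 0) = T₁ at *
  generalize fderiv ℝ Φ.T z (0, 1, 0) = T₂ at *
  generalize fderiv ℝ Φ.T z (0, 0, 1) = T₃ at *
  generalize fderiv ℝ Φ.X z (1, 0, 0) = X₁ at *
  generalize fderiv ℝ Φ.X z (0, 1, 0) = X₂ at *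
  generalize fderiv ℝ Φ.X z (0, 0, 1) = X₃ at *
  -- The `pq`-terms of the Jacobian cancel, leaving `A + q C + p B` with `A`, `B`, `C` the minors of
  -- `(dT, dX)` up to sign. If `B = 0`, then `A` or `C` is nonzero and a generic `q` suffices;
  -- otherwise `p` is chosen to make the Jacobian `1`.
  by_cases hB : T₃ * X₂ - T₂ * X₃ = 0
  · have hAC : T₁ * X₂ - T₂ * X₁ ≠ 0 ∨ T₁ * X₃ - T₃ * X₁ ≠ 0 := by
      by_contra hcon
      push Not at hcon
      obtain ⟨hA, hC⟩ := hcon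
      -- Cauchy–Binet for preimages of the first two basis vectors: the unit determinant is a
      -- combination of the three minors.
      have : (1 : ℝ) = 0 := by
        calc (1 : ℝ) = 1 * 1 - 0 * 0 := by ring
          _ = (v₁ * T₁ + v₂ * T₂ + v₃ * T₃) * (w₁ * X₁ + w₂ * X₂ + w₃ * X₃)
            - (w₁ * T₁ + w₂ * T₂ + w₃ * T₃) * (v₁ * X₁ + v₂ * X₂ + v₃ * X₃) := by
              rw [hv1, hv2, hw1, hw2]
          _ = (v₁ * w₂ - v₂ * w₁) * (T₁ * X₂ - T₂ * X₁) + (v₁ * w₃ - v₃ * w₁) * (T₁ * X₃ - T₃ * X₁)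
            - (v₂ * w₃ - v₃ * w₂) * (T₃ * X₂ - T₂ * X₃) := by ring
          _ = 0 := by rw [hA, hB, hC]; ring
      norm_num at this
    obtain ⟨q, hq1, hq2⟩ := exists_affine_ne_zero hT hAC
    refine ⟨0, q, hq1, fun h => hq2 ?_⟩
    linear_combination h
  · obtain ⟨q, hq, -⟩ := exists_affine_ne_zero hT (Or.inl (one_ne_zero (α := ℝ)) : _ ∨ (0 : ℝ) ≠ 0)
    refine ⟨(1 - (T₁ * X₂ - T₂ * X₁) - q * (T₁ * X₃ - T₃ * X₁)) / (T₃ * X₂ - T₂ * X₃), q, hq,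
      fun h => one_ne_zero (α := ℝ) ?_⟩
    have : (1 - (T₁ * X₂ - T₂ * X₁) - q * (T₁ * X₃ - T₃ * X₁)) / (T₃ * X₂ - T₂ * X₃)
      * (T₃ * X₂ - T₂ * X₃) = 1 - (T₁ * X₂ - T₂ * X₁) - q * (T₁ * X₃ - T₃ * X₁) :=
        div_mul_cancel₀ _ hB
    linear_combination h - this

/-- Telescoping: `f^(N+1) - (k s)^(N+1) = f (f^N - (k s)^N) + (f - k s) (k s)^N`, with `f = O(s)`
and `f - k s = o(s)`. -/
theorem pow_expansion {f : ℝ → ℝ} {k : ℝ} (hf : HasDerivAt f k 0) (h0 : f 0 = 0) (N : ℕ) :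
    (fun s => f s ^ N - k ^ N * s ^ N) =o[𝓝 0] (fun s : ℝ => s ^ N) := by
  have h1 : (fun s => f s - k * s) =o[𝓝 0] (fun s : ℝ => s) := by
    have := hasDerivAt_iff_isLittleO.1 hf
    simpa [h0, mul_comm] using this
  have hO : f =O[𝓝 0] (fun s : ℝ => s) := by
    have h2 : (fun s : ℝ => k * s) =O[𝓝 0] (fun s : ℝ => s) :=
      (Asymptotics.isBigO_refl _ _).const_mul_left k
    exact (h1.isBigO.add h2).congr_left fun s => by ring
  induction N with
  | zero => simp
  | succ N ih =>
    have e1 := hO.mul_isLittleO ih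
    have e2 : (fun s => (f s - k * s) * (k ^ N * s ^ N)) =o[𝓝 0] (fun s : ℝ => s * s ^ N) :=
      h1.mul_isBigO ((Asymptotics.isBigO_refl _ _).const_mul_left _)
    exact (e1.add e2).congr (fun s => by ring) (fun s => by ring)

/-- The new time does not depend on `x` and `u`. -/
theorem fderiv_T_eq_zero {Φ : Transformation} {Ω : Set (ℝ × ℝ × ℝ)} {t x u₀ : ℝ}
    (hΦ : RegularAt Φ (t, x, u₀)) (hz : (t, x, u₀) ∈ Ω) (hu₀ : u₀ ≠ 0) {a b s : ℝ} {n : ℤ}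
    (hs : s ≠ 0) {θ' : Elements}
    (hmap : Φ.MapsEquation Ω ⟨fun _ => a, fun _ => b, fun _ => s, n⟩ θ')
    (hσ : θ'.σ (Φ.T (t, x, u₀)) ≠ 0) :
    fderiv ℝ Φ.T (t, x, u₀) (0, 1, 0) = 0 ∧ fderiv ℝ Φ.T (t, x, u₀) (0, 0, 1) = 0 := by
  by_contra hcon
  rw [not_and_or] at hcon
  obtain ⟨p, q, hq, hJ⟩ := exists_generic_jet hΦ hcon
  -- The fifth-order coefficient is free because `s ≠ 0`, so it absorbs the equation for any
  -- first-order jet.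
  let e := -(p + a * u₀ ^ n * q) / (120 * s)
  have he : 120 * s * e = -(p + a * u₀ ^ n * q) := by
    simp only [e]; field_simp
  let u := jetPoly t x u₀ p 0 q 0 0 e
  -- The difference `(t - t₀)^5` is invisible to the source equation, which contains only `u_t`. In
  -- the target it produces a fifth space derivative as soon as `t` varies to first order along the
  -- curve of constant new time.
  let w := jetPoly t x u₀ p 1 q 0 0 e
  have hbw := bijective_of_jacobian_ne_zero (m := 1) (r := 0) (l := 0) (e := e) hΦ hJ
  obtain ⟨d, c, g, η, hd, hc, -, hg0, hg, hη, -, hexp, hfd, -, heq⟩ :=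
    exists_variation (u := u) (w := w) (by simpa [u] using hΦ)
      (contDiff_jetPoly ..).contDiffAt (contDiff_jetPoly ..).contDiffAt (by simp [u, w])
      (bijective_of_jacobian_ne_zero hΦ hJ) hbw
  have heq' := heq Ω _ θ' (by simpa [u] using hz) hmap
    (satisfiesAt_jetPoly t x p 0 q 0 0 e hu₀ (by linear_combination he))
    (satisfiesAt_jetPoly t x p 1 q 0 0 e hu₀ (by linear_combination he))
  have hφ : ∀ s, w (g s).1 (g s).2 - u (g s).1 (g s).2 = ((g s).1 - t) ^ 5 := fun s => by
    simp only [u, w, jetPoly]; ring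
  simp only [hφ] at hexp
  have hg1 : HasDerivAt (fun s => (g s).1 - t) η.1 0 := by
    have h := (hasFDerivAt_fst (𝕜 := ℝ) (E := ℝ) (F := ℝ) (p := g 0)).comp_hasDerivAt 0 hg
    exact h.sub_const t
  have hpow := pow_expansion hg1 (by simp [hg0]) 5
  have hO : (fun s => ((g s).1 - t) ^ 5) =O[𝓝 0] (fun s : ℝ => s ^ 5) :=
    (hpow.isBigO.add ((Asymptotics.isBigO_refl _ _).const_mul_left (η.1 ^ 5))).congr_left
      fun s => by ring
  have hexp' := (hexp.trans_isBigO hO).add (hpow.const_mul_left c)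
  obtain ⟨h1, h3, h5⟩ := derivs_of_expansion (f := d (Φ.alongGraph w (t, x)).1)
    (x₀ := (Φ.alongGraph w (t, x)).2) (c₁ := 0) (c₃ := 0) (c₄ := 0) (c₅ := c * η.1 ^ 5)
    (contDiffAt_slice hd) (hexp'.congr_left fun s => by ring)
  obtain ⟨y, hy⟩ := hbw.2 (1, 0)
  have hT := hfd y
  rw [show fderiv ℝ (Φ.alongGraph w) (t, x) y = (1, 0) from hy, fderiv_jetPoly, fderiv_jetPoly,
    sub_self, mul_zero] at hT
  have hgu : graphMap u (t, x) = (t, x, u₀) := graphMap_jetPoly ..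
  rw [hT, h1, h3, h5, hgu] at heq'
  -- Only the fifth-order term of the linear relation is left. Once `η.1 = 0`, constancy of the new
  -- time and `D_x T ≠ 0` give `η = 0`, although its image is `(0, 1)`.
  have hη1 : η.1 = 0 := by
    have : θ'.σ (Φ.T (t, x, u₀)) * (120 * (c * η.1 ^ 5)) = 0 := by linear_combination heq'
    simpa [hσ, hc] using this
  rw [fderiv_alongGraph_jetPoly hΦ, hη1] at hη
  obtain ⟨e1, e2⟩ := Prod.mk.inj hη
  rw [map_triple] at e1
  have hη2 : η.2 = 0 := by
    refine (mul_eq_zero.1 ?_).resolve_right hq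
    linear_combination e1
  simp only [hη2, mul_zero, add_zero, Prod.mk_zero_zero, map_zero] at e2
  exact zero_ne_one e2

/-! ### The space component. -/

theorem fderiv_T_apply {Φ : Transformation} {Ω : Set (ℝ × ℝ × ℝ)} {z : ℝ × ℝ × ℝ}
    (hΩ : IsOpen Ω) (hz : z ∈ Ω) {τ : ℝ → ℝ} (hT : ∀ z ∈ Ω, Φ.T z = τ z.1)
    {k : ℝ} (hτ : HasDerivAt τ k z.1) (v : ℝ × ℝ × ℝ) : fderiv ℝ Φ.T z v = k * v.1 := by
  have h1 := hτ.hasFDerivAt.comp z (hasFDerivAt_fst (𝕜 := ℝ) (E := ℝ) (F := ℝ × ℝ))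
  have h2 : HasFDerivAt Φ.T _ z := h1.congr_of_eventuallyEq (by
    filter_upwards [hΩ.mem_nhds hz] with y hy using hT y hy)
  rw [h2.fderiv]
  simp [mul_comm]

/-- Variation of a polynomial jet, when the new time is a function of `t` only. -/
theorem exists_jet_variation {Φ : Transformation} {Ω : Set (ℝ × ℝ × ℝ)} {t x u₀ : ℝ}
    (hΩ : IsOpen Ω) (hz : (t, x, u₀) ∈ Ω) (hΦ : RegularAt Φ (t, x, u₀)) (hu₀ : u₀ ≠ 0)
    {τ : ℝ → ℝ} (hT : ∀ z ∈ Ω, Φ.T z = τ z.1) {k : ℝ} (hτ : HasDerivAt τ k t) (hk : k ≠ 0)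
    {p q e p' q' r' l' e' : ℝ}
    (hX : fderiv ℝ Φ.X (t, x, u₀) (0, 1, 0) + q * fderiv ℝ Φ.X (t, x, u₀) (0, 0, 1) ≠ 0)
    (hX' : fderiv ℝ Φ.X (t, x, u₀) (0, 1, 0) + q' * fderiv ℝ Φ.X (t, x, u₀) (0, 0, 1) ≠ 0)
    {u w : ℝ → ℝ → ℝ} (hu : u = jetPoly t x u₀ p 0 q 0 0 e)
    (hw : w = jetPoly t x u₀ p' 0 q' r' l' e') :
    ∃ (f : ℝ → ℝ) (c D : ℝ) (g : ℝ → ℝ), ContDiffAt ℝ ∞ f (Φ.X (t, x, u₀)) ∧ c ≠ 0 ∧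
      (fderiv ℝ Φ.X (t, x, u₀) (0, 0, 1) = 0 → c = fderiv ℝ Φ.U (t, x, u₀) (0, 0, 1)) ∧
      g 0 = x ∧ HasDerivAt g (fderiv ℝ Φ.X (t, x, u₀) (0, 1, 0)
        + q' * fderiv ℝ Φ.X (t, x, u₀) (0, 0, 1))⁻¹ 0 ∧
      (∀ᶠ s in 𝓝 0, (t, g s, w t (g s)) ∈ Ω ∧ (t, g s, u t (g s)) ∈ Ω ∧
        Φ.X (t, g s, w t (g s)) = Φ.X (t, x, u₀) + s) ∧
      (fun s => f (Φ.X (t, x, u₀) + s) - c * (w t (g s) - u t (g s)))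
        =o[𝓝 0] (fun s => w t (g s) - u t (g s)) ∧
      k * D + (fderiv ℝ Φ.X (t, x, u₀) (1, 0, 0) + p' * fderiv ℝ Φ.X (t, x, u₀) (0, 0, 1))
        * deriv f (Φ.X (t, x, u₀)) = c * (p' - p) ∧
      ((∀ᶠ y in 𝓝 (t, x), Φ.alongGraph u y = Φ.alongGraph w y) → ∀ᶠ s in 𝓝 0,
        f (Φ.X (t, x, u₀) + s) = Φ.U (t, g s, w t (g s)) - Φ.U (t, g s, u t (g s))) ∧
      ∀ (a b s : ℝ) (n : ℤ) (θ' : Elements), p + a * u₀ ^ n * q + 120 * s * e = 0 →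
        p' + a * u₀ ^ n * q' + 6 * b * r' + 120 * s * e' = 0 →
        Φ.MapsEquation Ω ⟨fun _ => a, fun _ => b, fun _ => s, n⟩ θ' →
        D + θ'.α (τ t) * Φ.U (t, x, u₀) ^ θ'.n * deriv f (Φ.X (t, x, u₀))
          + θ'.β (τ t) * iteratedDeriv 3 f (Φ.X (t, x, u₀))
          + θ'.σ (τ t) * iteratedDeriv 5 f (Φ.X (t, x, u₀)) = 0 := by
  have hTf := fun v => fderiv_T_apply hΩ hz hT hτ v
  have hbij : ∀ {p q r l e : ℝ}, fderiv ℝ Φ.X (t, x, u₀) (0, 1, 0)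
      + q * fderiv ℝ Φ.X (t, x, u₀) (0, 0, 1) ≠ 0 →
      Function.Bijective (fderiv ℝ (Φ.alongGraph (jetPoly t x u₀ p 0 q r l e)) (t, x)) := by
    intro p q r l e h
    refine bijective_of_jacobian_ne_zero hΦ ?_
    simp only [hTf]
    simpa using ⟨hk, h⟩
  have hbw := hbij (p := p') (r := r') (l := l') (e := e') hX'
  have hgu : graphMap u (t, x) = (t, x, u₀) := by rw [hu]; exact graphMap_jetPoly ..
  have hgw : graphMap w (t, x) = (t, x, u₀) := by rw [hw]; exact graphMap_jetPoly ..
  have hus : ContDiffAt ℝ ∞ (Function.uncurry u) (t, x) := by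
    rw [hu]; exact (contDiff_jetPoly ..).contDiffAt
  have hws : ContDiffAt ℝ ∞ (Function.uncurry w) (t, x) := by
    rw [hw]; exact (contDiff_jetPoly ..).contDiffAt
  obtain ⟨d, c, g, η, hd, hc, hcU, hg0, hg, hη, hFg, hexp, hfd, hFF, heq⟩ :=
    exists_variation (u := u) (w := w) (by rwa [hgu]) hus hws (by simp [hu, hw])
      (by rw [hu]; exact hbij hX) (by rw [hw]; exact hbw)
  have hζ1 : (Φ.alongGraph w (t, x)).1 = τ t := by
    change Φ.T (graphMap w (t, x)) = _
    rw [hgw]; exact hT _ hz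
  have hζ2 : (Φ.alongGraph w (t, x)).2 = Φ.X (t, x, u₀) := by
    change Φ.X (graphMap w (t, x)) = _
    rw [hgw]
  have hζ : Φ.alongGraph w (t, x) = (τ t, Φ.X (t, x, u₀)) := Prod.ext hζ1 hζ2
  simp only [hζ, hgu] at hd hFg hexp hfd hFF heq hcU
  have hgt : Tendsto g (𝓝 0) (𝓝 (t, x)) := by
    have := hg.continuousAt.tendsto
    rwa [hg0] at this
  have hmemw : ∀ᶠ y in 𝓝 (t, x), graphMap w y ∈ Ω :=
    (contDiffAt_graphMap hws).continuousAt.eventually_mem (hΩ.mem_nhds (by rwa [hgw]))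
  have hmemu : ∀ᶠ y in 𝓝 (t, x), graphMap u y ∈ Ω :=
    (contDiffAt_graphMap hus).continuousAt.eventually_mem (hΩ.mem_nhds (by rwa [hgu]))
  -- Since `τ` has nonzero derivative at `t`, constant new time near `t` means constant old time.
  have hgfst : ∀ᶠ s in 𝓝 0, (g s).1 = t := by
    have h1 : ∀ᶠ y in 𝓝 t, τ y = τ t → y = t := by
      have := hτ.eventually_ne (c := τ t) hk
      rw [eventually_nhdsWithin_iff] at this
      filter_upwards [this] with y hy h
      by_contra hne
      exact hy hne h
    have h2 : Tendsto (fun s => (g s).1) (𝓝 0) (𝓝 t) := (continuous_fst.tendsto (t, x)).comp hgt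
    filter_upwards [hFg, hgt.eventually hmemw, h2.eventually h1] with s e1 e2 e3
    refine e3 ?_
    have e4 : Φ.T (graphMap w (g s)) = τ t := (Prod.mk.inj e1).1
    rw [hT _ e2] at e4
    exact e4
  have hgpair : ∀ᶠ s in 𝓝 0, g s = (t, (g s).2) := by
    filter_upwards [hgfst] with s hs using Prod.ext hs rfl
  have hL : ∀ v, fderiv ℝ (Φ.alongGraph w) (t, x) v = (fderiv ℝ Φ.T (t, x, u₀)
      (v.1, v.2, p' * v.1 + q' * v.2), fderiv ℝ Φ.X (t, x, u₀) (v.1, v.2, p' * v.1 + q' * v.2)) := by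
    intro v; rw [hw]; exact fderiv_alongGraph_jetPoly hΦ ..
  have hη2 : η.2 = (fderiv ℝ Φ.X (t, x, u₀) (0, 1, 0)
      + q' * fderiv ℝ Φ.X (t, x, u₀) (0, 0, 1))⁻¹ := by
    rw [hL] at hη
    obtain ⟨e1, e2⟩ := Prod.mk.inj hη
    rw [hTf] at e1
    have e3 : η.1 = 0 := (mul_eq_zero.1 e1).resolve_left hk
    rw [map_triple, e3] at e2
    exact eq_inv_of_mul_eq_one_left (by linear_combination e2)
  have hdf := (hd.differentiableAt (by simp) : DifferentiableAt ℝ _ _)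
  refine ⟨d (τ t), c, fderiv ℝ (Function.uncurry d) (τ t, Φ.X (t, x, u₀)) (1, 0),
    fun s => (g s).2, contDiffAt_slice hd, hc, fun h => hcU (by rw [hTf]; simp) h,
    by simp [hg0], ?_, ?_, ?_, ?_, ?_, ?_⟩
  · rw [← hη2]
    exact (hasFDerivAt_snd (𝕜 := ℝ) (E := ℝ) (F := ℝ) (p := g 0)).comp_hasDerivAt 0 hg
  · filter_upwards [hgpair, hFg, hgt.eventually hmemw, hgt.eventually hmemu] with s e1 e2 e3 e4
    rw [e1] at e2 e3 e4
    exact ⟨e3, e4, (Prod.mk.inj e2).2⟩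
  · refine hexp.congr' ?_ ?_ <;>
    · filter_upwards [hgfst] with s hs
      simp only [hs]
  · have h1 := hfd (1, 0)
    rw [hL, hTf, map_triple, hu, hw, fderiv_jetPoly, fderiv_jetPoly] at h1
    rw [deriv_snd_eq_fderiv hdf]
    set X' := fderiv ℝ Φ.X (t, x, u₀) (1, 0, 0) + p' * fderiv ℝ Φ.X (t, x, u₀) (0, 0, 1) with hX'def
    have h2 : (k * ((1 : ℝ), (0 : ℝ), p' * 1 + q' * 0).1, 1 * fderiv ℝ Φ.X (t, x, u₀) (1, 0, 0)
        + 0 * fderiv ℝ Φ.X (t, x, u₀) (0, 1, 0)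
        + (p' * 1 + q' * 0) * fderiv ℝ Φ.X (t, x, u₀) (0, 0, 1))
        = k • ((1, 0) : ℝ × ℝ) + X' • ((0, 1) : ℝ × ℝ) := by
      ext <;> simp [X']
    simp only at h2 h1
    rw [h2, map_add, map_smul, map_smul] at h1
    simp only [smul_eq_mul] at h1
    linear_combination h1
  · intro h
    filter_upwards [hgpair, hFF (by simpa only [hw] using h)] with s e1 e2
    rw [e1] at e2
    exact e2
  · intro a b s n θ' h1 h2 hmap
    have := heq Ω _ θ' hz hmap
      (by rw [hu]; exact satisfiesAt_jetPoly t x p 0 q 0 0 e hu₀ (by linear_combination h1))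
      (by rw [hw]; exact satisfiesAt_jetPoly t x p' 0 q' r' l' e' hu₀ (by linear_combination h2))
    rw [hT _ hz] at this
    exact this

/-- The bracket is the total derivative `D_x X`. A fifth-order variation in `x` has transform of
leading term `c (y / D_x X)^5`, and the `t`-slope that balances it in the source fixes the ratio of
the leading coefficients. -/
theorem sigma_relation {Φ : Transformation} {Ω : Set (ℝ × ℝ × ℝ)} {t x u₀ : ℝ}
    (hΩ : IsOpen Ω) (hz : (t, x, u₀) ∈ Ω) (hΦ : RegularAt Φ (t, x, u₀)) (hu₀ : u₀ ≠ 0)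
    {τ : ℝ → ℝ} (hT : ∀ z ∈ Ω, Φ.T z = τ z.1) {k : ℝ} (hτ : HasDerivAt τ k t) (hk : k ≠ 0)
    {a b s : ℝ} {n : ℤ} {θ' : Elements}
    (hmap : Φ.MapsEquation Ω ⟨fun _ => a, fun _ => b, fun _ => s, n⟩ θ') {q : ℝ}
    (hX : fderiv ℝ Φ.X (t, x, u₀) (0, 1, 0) + q * fderiv ℝ Φ.X (t, x, u₀) (0, 0, 1) ≠ 0) :
    θ'.σ (τ t) * k = s * (fderiv ℝ Φ.X (t, x, u₀) (0, 1, 0)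
      + q * fderiv ℝ Φ.X (t, x, u₀) (0, 0, 1)) ^ 5 := by
  -- Here `w - u = (x - x₀)^5 - 120 s (t - t₀)`, where `120 = 5!` keeps `w` on the source equation.
  obtain ⟨f, c, D, g, hf, hc, -, hg0, hg, -, hexp, hD, -, heq⟩ :=
    exists_jet_variation (p := -(a * u₀ ^ n * q)) (e := 0) (p' := -(a * u₀ ^ n * q) - 120 * s)
      (r' := 0) (l' := 0) (e' := 1) hΩ hz hΦ hu₀ hT hτ hk hX hX rfl rfl
  set K := fderiv ℝ Φ.X (t, x, u₀) (0, 1, 0) + q * fderiv ℝ Φ.X (t, x, u₀) (0, 0, 1) with hK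
  have hφ : ∀ r, jetPoly t x u₀ (-(a * u₀ ^ n * q) - 120 * s) 0 q 0 0 1 t (g r)
      - jetPoly t x u₀ (-(a * u₀ ^ n * q)) 0 q 0 0 0 t (g r) = (g r - x) ^ 5 := fun r => by
    simp only [jetPoly]; ring
  simp only [hφ] at hexp
  have hpow := pow_expansion (hg.sub_const x) (by simp [hg0]) 5
  have hO : (fun r => (g r - x) ^ 5) =O[𝓝 0] (fun r : ℝ => r ^ 5) :=
    (hpow.isBigO.add ((Asymptotics.isBigO_refl _ _).const_mul_left (K⁻¹ ^ 5))).congr_left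
      fun r => by ring
  have hexp' := (hexp.trans_isBigO hO).add (hpow.const_mul_left c)
  obtain ⟨h1, h3, h5⟩ := derivs_of_expansion (c₁ := 0) (c₃ := 0) (c₄ := 0) (c₅ := c * K⁻¹ ^ 5)
    hf (hexp'.congr_left fun r => by ring)
  have e := heq a b s n θ' (by ring) (by ring) hmap
  rw [h1] at hD e
  rw [h3, h5] at e
  have hcD : c * (θ'.σ (τ t) * k * K⁻¹ ^ 5 - s) = 0 := by
    linear_combination (k / 120) * e - (1 / 120) * hD
  have h0 := (mul_eq_zero.1 hcD).resolve_left hc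
  have hKK : K⁻¹ ^ 5 * K ^ 5 = 1 := by rw [← mul_pow, inv_mul_cancel₀ hX, one_pow]
  linear_combination K ^ 5 * h0 - θ'.σ (τ t) * k * hKK

/-- The new space variable does not depend on `u`. -/
theorem fderiv_X_eq_zero {Φ : Transformation} {Ω : Set (ℝ × ℝ × ℝ)} {t x u₀ : ℝ}
    (hΩ : IsOpen Ω) (hz : (t, x, u₀) ∈ Ω) (hΦ : RegularAt Φ (t, x, u₀)) (hu₀ : u₀ ≠ 0)
    {τ : ℝ → ℝ} (hT : ∀ z ∈ Ω, Φ.T z = τ z.1) {k : ℝ} (hτ : HasDerivAt τ k t) (hk : k ≠ 0)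
    {a b s : ℝ} {n : ℤ} (hs : s ≠ 0) {θ' : Elements}
    (hmap : Φ.MapsEquation Ω ⟨fun _ => a, fun _ => b, fun _ => s, n⟩ θ') :
    fderiv ℝ Φ.X (t, x, u₀) (0, 0, 1) = 0 ∧ fderiv ℝ Φ.X (t, x, u₀) (0, 1, 0) ≠ 0 ∧
      fderiv ℝ Φ.U (t, x, u₀) (0, 0, 1) ≠ 0 ∧
      θ'.σ (τ t) * k = s * fderiv ℝ Φ.X (t, x, u₀) (0, 1, 0) ^ 5 := by
  have hTf := fun v => fderiv_T_apply hΩ hz hT hτ v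
  have hXu : fderiv ℝ Φ.X (t, x, u₀) (0, 0, 1) = 0 := by
    by_contra h
    -- If `X_u ≠ 0`, a suitable slope gives `D_x X` any value. The values `1` and `2` yield the same
    -- left side in `sigma_relation`, so `(2^5 - 1) s = 0`.
    have hq : ∀ r : ℝ, fderiv ℝ Φ.X (t, x, u₀) (0, 1, 0)
        + (r - fderiv ℝ Φ.X (t, x, u₀) (0, 1, 0)) / fderiv ℝ Φ.X (t, x, u₀) (0, 0, 1)
          * fderiv ℝ Φ.X (t, x, u₀) (0, 0, 1) = r := fun r => by field_simp; ring
    have e1 := sigma_relation hΩ hz hΦ hu₀ hT hτ hk hmap (by rw [hq 1]; norm_num)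
    have e2 := sigma_relation hΩ hz hΦ hu₀ hT hτ hk hmap (by rw [hq 2]; norm_num)
    rw [hq] at e1 e2
    exact hs (by linear_combination (e1 - e2) / 31)
  have hUu : fderiv ℝ Φ.U (t, x, u₀) (0, 0, 1) ≠ 0 := fun hU => by
    have := hΦ.injective (0, 0, 1) (by rw [hTf]; simp) hXu hU
    simp at this
  have hXx : fderiv ℝ Φ.X (t, x, u₀) (0, 1, 0) ≠ 0 := fun hX => by
    -- With `T_x = T_u = X_x = X_u = 0`, the vector `(0, U_u, -U_x)` is in the kernel of all three
    -- differentials.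
    have := hΦ.injective (0, fderiv ℝ Φ.U (t, x, u₀) (0, 0, 1), -fderiv ℝ Φ.U (t, x, u₀) (0, 1, 0))
      (by rw [hTf]; simp) (by rw [map_triple, hXu, hX]; ring) (by rw [map_triple]; ring)
    simp only [Prod.mk_eq_zero] at this
    exact hUu this.2.1
  refine ⟨hXu, hXx, hUu, ?_⟩
  have := sigma_relation (q := 0) hΩ hz hΦ hu₀ hT hτ hk hmap (by simpa using hXx)
  simpa using this

/-! ### The dependent variable and the transformed coefficients. -/

/-- Expansion of the increment of `U` under a quartic variation of an affine function. -/
theorem quartic_increment {U : ℝ × ℝ × ℝ → ℝ} {t x u₀ q : ℝ} (hU : ContDiffAt ℝ ∞ U (t, x, u₀)) :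
    (fun y => U (t, x + y, u₀ + q * y + y ^ 4) - U (t, x + y, u₀ + q * y)
      - (fderiv ℝ U (t, x, u₀) (0, 0, 1) * y ^ 4
        + fderiv ℝ (fun z => fderiv ℝ U z (0, 0, 1)) (t, x, u₀) (0, 1, q) * y ^ 5))
      =o[𝓝 0] (fun y : ℝ => y ^ 5) := by
  set h : ℝ × ℝ × ℝ → ℝ := fun z => fderiv ℝ U z (0, 0, 1) with hh
  have hhd : ContDiffAt ℝ ∞ h (t, x, u₀) :=
    (hU.fderiv_right (m := ∞) (by simp)).clm_apply contDiffAt_const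
  have hdiff : ∀ᶠ z in 𝓝 (t, x, u₀), DifferentiableAt ℝ U z :=
    (((hU.of_le (natCast_le_infty 1)).eventually (by simp)).mono fun z hz => hz.differentiableAt (by simp))
  obtain ⟨ε, hε, hball⟩ := Metric.eventually_nhds_iff.1 hdiff
  have hcont : Continuous fun y : ℝ => |y| + |q * y| + y ^ 4 := by fun_prop
  have hsmall : ∀ᶠ y in 𝓝 (0 : ℝ), |y| + |q * y| + y ^ 4 < ε :=
    (hcont.tendsto 0).eventually_lt_const (by simpa using hε)
  -- Mean value theorem in `u`, with the intermediate offset `ξ` made total by the value `0` for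
  -- large `y`. As `ξ = O(y^4)`, it does not affect the first-order expansion of `U_u` along the
  -- curve.
  have hξ : ∀ y : ℝ, ∃ ξ, |ξ| ≤ y ^ 4 ∧ (|y| + |q * y| + y ^ 4 < ε →
      U (t, x + y, u₀ + q * y + y ^ 4) - U (t, x + y, u₀ + q * y)
        = h (t, x + y, u₀ + q * y + ξ) * y ^ 4) := by
    intro y
    by_cases hy : y = 0
    · exact ⟨0, by simp [hy], fun _ => by simp [hy]⟩
    have hy4 : 0 < y ^ 4 := by positivity
    by_cases hyε : |y| + |q * y| + y ^ 4 < ε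
    · have hd : ∀ r ∈ Icc 0 (y ^ 4), HasDerivAt (fun r => U (t, x + y, u₀ + q * y + r))
          (h (t, x + y, u₀ + q * y + r)) r := by
        intro r hr
        have hU' : DifferentiableAt ℝ U (t, x + y, u₀ + q * y + r) := by
          refine hball ?_
          have h1 : |q * y + r| ≤ |q * y| + y ^ 4 := (abs_add_le _ _).trans (by
            rw [abs_of_nonneg hr.1]; linarith [hr.2])
          have h2 := abs_nonneg y
          have h3 := abs_nonneg (q * y)
          rw [Prod.dist_eq, Prod.dist_eq, max_lt_iff, max_lt_iff]
          refine ⟨by simpa using hε, ?_, ?_⟩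
          · rw [Real.dist_eq, add_sub_cancel_left]; linarith
          · rw [Real.dist_eq, add_assoc, add_sub_cancel_left]; linarith
        have hl : HasDerivAt (fun r => (t, x + y, u₀ + q * y + r)) ((0, 0, 1) : ℝ × ℝ × ℝ) r :=
          (hasDerivAt_const r t).prodMk ((hasDerivAt_const r (x + y)).prodMk
            ((hasDerivAt_id r).const_add _))
        exact hU'.hasFDerivAt.comp_hasDerivAt r hl
      obtain ⟨ξ, hξ, hξ'⟩ := exists_hasDerivAt_eq_slope
        (fun r => U (t, x + y, u₀ + q * y + r)) (fun r => h (t, x + y, u₀ + q * y + r)) hy4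
        (fun r hr => (hd r hr).continuousAt.continuousWithinAt)
        (fun r hr => hd r (Ioo_subset_Icc_self hr))
      refine ⟨ξ, by rw [abs_of_pos hξ.1]; exact hξ.2.le, fun _ => ?_⟩
      rw [hξ']
      simp only [add_zero, sub_zero]
      field_simp
    · exact ⟨0, by simpa using hy4.le, fun h => absurd h hyε⟩
  choose ξ hξ1 hξ2 using hξ
  have hξo : ξ =o[𝓝 0] (fun y : ℝ => y) := by
    have h1 : ξ =O[𝓝 0] (fun y : ℝ => y ^ 4) :=
      Asymptotics.IsBigO.of_bound 1 (Eventually.of_forall fun y => by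
        rw [Real.norm_eq_abs, Real.norm_eq_abs, one_mul, abs_of_nonneg (by positivity : 0 ≤ y ^ 4)]
        exact hξ1 y)
    have h2 : (fun y : ℝ => y ^ 4) =o[𝓝 0] (fun y : ℝ => y) := by
      simpa using Asymptotics.isLittleO_pow_pow (𝕜 := ℝ) (m := 1) (n := 4) (by norm_num)
    exact h1.trans_isLittleO h2
  have hγ : HasDerivAt (fun y => ((t, x + y, u₀ + q * y + ξ y) : ℝ × ℝ × ℝ)) (0, 1, q) 0 := by
    have hξ0 : ξ 0 = 0 := by simpa using hξ1 0
    have h1 : HasDerivAt ξ 0 0 := by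
      rw [hasDerivAt_iff_isLittleO]
      simpa [hξ0] using hξo
    have h2 : HasDerivAt (fun y => u₀ + q * y + ξ y) (q * 1 + 0) 0 :=
      (((hasDerivAt_id (0 : ℝ)).const_mul q).const_add u₀).add h1
    rw [mul_one, add_zero] at h2
    exact (hasDerivAt_const (0 : ℝ) t).prodMk (((hasDerivAt_id (0 : ℝ)).const_add x).prodMk h2)
  have hγ0 : (fun y => ((t, x + y, u₀ + q * y + ξ y) : ℝ × ℝ × ℝ)) 0 = (t, x, u₀) := by
    have hξ0 : ξ 0 = 0 := by simpa using hξ1 0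
    simp [hξ0]
  have hhγ : HasDerivAt (fun y => h (t, x + y, u₀ + q * y + ξ y))
      (fderiv ℝ h (t, x, u₀) (0, 1, q)) 0 := by
    have : HasFDerivAt h (fderiv ℝ h (t, x, u₀))
        ((fun y => ((t, x + y, u₀ + q * y + ξ y) : ℝ × ℝ × ℝ)) 0) := by
      rw [hγ0]; exact (hhd.differentiableAt (by simp)).hasFDerivAt
    exact this.comp_hasDerivAt 0 hγ
  have hexp := hasDerivAt_iff_isLittleO.1 hhγ
  have h0 : h (t, x + 0, u₀ + q * 0 + ξ 0) = h (t, x, u₀) := congrArg h hγ0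
  rw [h0] at hexp
  simp only [sub_zero, smul_eq_mul] at hexp
  refine (hexp.mul_isBigO (Asymptotics.isBigO_refl (fun y : ℝ => y ^ 4) (𝓝 0))).congr' ?_ ?_
  · filter_upwards [hsmall] with y hy
    rw [hξ2 y hy]
    ring
  · filter_upwards with y
    ring

/-- Once the new independent variables do not involve `u`, the difference of two transforms is
exactly the increment of `U`, with no error term. -/
theorem eventually_alongGraph_eq {Φ : Transformation} {Ω : Set (ℝ × ℝ × ℝ)} {t x : ℝ}
    (hΩ : IsOpen Ω) {τ : ℝ → ℝ} (hT : ∀ z ∈ Ω, Φ.T z = τ z.1)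
    (hX : ∀ z ∈ Ω, ∀ z' ∈ Ω, z.1 = z'.1 → z.2.1 = z'.2.1 → Φ.X z = Φ.X z')
    {u w : ℝ → ℝ → ℝ} (hu : ContinuousAt (graphMap u) (t, x))
    (hw : ContinuousAt (graphMap w) (t, x)) (hu0 : graphMap u (t, x) ∈ Ω)
    (hw0 : graphMap w (t, x) ∈ Ω) :
    ∀ᶠ y in 𝓝 (t, x), Φ.alongGraph u y = Φ.alongGraph w y := by
  filter_upwards [hu.eventually_mem (hΩ.mem_nhds hu0), hw.eventually_mem (hΩ.mem_nhds hw0)]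
    with y h1 h2
  refine Prod.ext ?_ (hX _ h1 _ h2 rfl rfl)
  exact (hT _ h1).trans (hT _ h2).symm

/-- The new dependent variable is affine in `u`, with a slope that does not depend on `x`. -/
theorem fderiv_U_slope_eq_zero {Φ : Transformation} {Ω : Set (ℝ × ℝ × ℝ)} {t x u₀ : ℝ}
    (hΩ : IsOpen Ω) (hz : (t, x, u₀) ∈ Ω) (hΦ : RegularAt Φ (t, x, u₀)) (hu₀ : u₀ ≠ 0)
    {τ : ℝ → ℝ} (hT : ∀ z ∈ Ω, Φ.T z = τ z.1) {k : ℝ} (hτ : HasDerivAt τ k t) (hk : k ≠ 0)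
    (hX : ∀ z ∈ Ω, ∀ z' ∈ Ω, z.1 = z'.1 → z.2.1 = z'.2.1 → Φ.X z = Φ.X z') {κ : ℝ} (hκ : κ ≠ 0)
    (hXs : ∀ y v, (t, y, v) ∈ Ω → Φ.X (t, y, v) = Φ.X (t, x, u₀) + κ * (y - x))
    (hXx : fderiv ℝ Φ.X (t, x, u₀) (0, 1, 0) = κ) (hXu : fderiv ℝ Φ.X (t, x, u₀) (0, 0, 1) = 0)
    {a b s : ℝ} {n : ℤ} {θ' : Elements}
    (hmap : Φ.MapsEquation Ω ⟨fun _ => a, fun _ => b, fun _ => s, n⟩ θ')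
    (hσ : θ'.σ (τ t) ≠ 0) (q : ℝ) :
    fderiv ℝ (fun z => fderiv ℝ Φ.U z (0, 0, 1)) (t, x, u₀) (0, 1, q) = 0 := by
  set u := jetPoly t x u₀ (-(a * u₀ ^ n * q)) 0 q 0 0 0 with hu
  -- The fourth derivative enters neither equation, so the `y^5` term of the increment, with
  -- coefficient `U_ux + q U_uu`, is the only one tested by the target.
  set w := jetPoly t x u₀ (-(a * u₀ ^ n * q)) 0 q 0 1 0 with hw
  obtain ⟨f, c, D, g, hf, hc, -, hg0, hg, hgX, -, hD, hfU, heq⟩ :=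
    exists_jet_variation (u := u) (w := w) hΩ hz hΦ hu₀ hT hτ hk
      (by rw [hXx, hXu]; simpa using hκ) (by rw [hXx, hXu]; simpa using hκ) hu hw
  have hFF := eventually_alongGraph_eq (u := u) (w := w) (t := t) (x := x) hΩ hT hX
    (contDiffAt_graphMap (contDiff_jetPoly ..).contDiffAt).continuousAt
    (contDiffAt_graphMap (contDiff_jetPoly ..).contDiffAt).continuousAt
    (by rw [graphMap_jetPoly]; exact hz) (by rw [graphMap_jetPoly]; exact hz)
  have hlin : Tendsto (fun r : ℝ => κ⁻¹ * r) (𝓝 0) (𝓝 0) := by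
    have : Continuous fun r : ℝ => κ⁻¹ * r := by fun_prop
    simpa using this.tendsto 0
  have hq := (quartic_increment (q := q) hΦ.smooth_U).comp_tendsto hlin
  set M := fderiv ℝ (fun z => fderiv ℝ Φ.U z (0, 0, 1)) (t, x, u₀) (0, 1, q)
  set N := fderiv ℝ Φ.U (t, x, u₀) (0, 0, 1)
  have hO : ((fun y : ℝ => y ^ 5) ∘ fun r : ℝ => κ⁻¹ * r) =O[𝓝 0] (fun r : ℝ => r ^ 5) :=
    ((Asymptotics.isBigO_refl (fun r : ℝ => r ^ 5) (𝓝 0)).const_mul_left (κ⁻¹ ^ 5)).congr_left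
      fun r => by simp only [Function.comp_apply]; ring
  have hexp : (fun r => f (Φ.X (t, x, u₀) + r)
      - (0 * r + 0 * r ^ 3 + N * κ⁻¹ ^ 4 * r ^ 4 + M * κ⁻¹ ^ 5 * r ^ 5)) =o[𝓝 0]
      (fun r : ℝ => r ^ 5) := by
    refine (hq.trans_isBigO hO).congr' ?_ EventuallyEq.rfl
    filter_upwards [hgX, hfU hFF] with r h1 h2
    have hgr : g r = x + κ⁻¹ * r := by
      have := h1.2.2
      rw [hXs _ _ h1.1] at this
      have h4 := inv_mul_cancel_left₀ hκ (g r - x)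
      rw [show κ * (g r - x) = r by linarith] at h4
      linarith
    have hur : u t (g r) = u₀ + q * (κ⁻¹ * r) := by rw [hgr, hu]; simp only [jetPoly]; ring
    have hwr : w t (g r) = u₀ + q * (κ⁻¹ * r) + (κ⁻¹ * r) ^ 4 := by
      rw [hgr, hw]; simp only [jetPoly]; ring
    rw [h2, hur, hwr, hgr]
    simp only [Function.comp_apply]
    ring
  obtain ⟨h1, h3, h5⟩ := derivs_of_expansion hf hexp
  have e := heq a b s n θ' (by ring) (by ring) hmap
  rw [h1] at hD e
  rw [h3, h5] at e
  have hD0 : D = 0 := by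
    refine (mul_eq_zero.1 ?_).resolve_left hk
    linear_combination hD
  have h6 : θ'.σ (τ t) * (κ⁻¹ ^ 5 * M) = 0 := by
    linear_combination (1 / 120) * e - (1 / 120) * hD0
  exact (mul_eq_zero.1 ((mul_eq_zero.1 h6).resolve_left hσ)).resolve_left
    (pow_ne_zero _ (inv_ne_zero hκ))

/-- The relations between the arbitrary elements and their transforms. -/
theorem alpha_beta_relation {Φ : Transformation} {Ω : Set (ℝ × ℝ × ℝ)} {t x u₀ : ℝ}
    (hΩ : IsOpen Ω) (hz : (t, x, u₀) ∈ Ω) (hΦ : RegularAt Φ (t, x, u₀)) (hu₀ : u₀ ≠ 0)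
    {τ : ℝ → ℝ} (hT : ∀ z ∈ Ω, Φ.T z = τ z.1) {k : ℝ} (hτ : HasDerivAt τ k t) (hk : k ≠ 0)
    (hX : ∀ z ∈ Ω, ∀ z' ∈ Ω, z.1 = z'.1 → z.2.1 = z'.2.1 → Φ.X z = Φ.X z') {κ : ℝ} (hκ : κ ≠ 0)
    (hXs : ∀ y v, (t, y, v) ∈ Ω → Φ.X (t, y, v) = Φ.X (t, x, u₀) + κ * (y - x))
    (hXx : fderiv ℝ Φ.X (t, x, u₀) (0, 1, 0) = κ) (hXu : fderiv ℝ Φ.X (t, x, u₀) (0, 0, 1) = 0)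
    {N : ℝ} (hN : N ≠ 0) (hNU : fderiv ℝ Φ.U (t, x, u₀) (0, 0, 1) = N)
    (hU : ∀ y v v', (t, y, v) ∈ Ω → (t, y, v') ∈ Ω →
      Φ.U (t, y, v') - Φ.U (t, y, v) = N * (v' - v))
    {a b s : ℝ} {n : ℤ} {θ' : Elements}
    (hmap : Φ.MapsEquation Ω ⟨fun _ => a, fun _ => b, fun _ => s, n⟩ θ') :
    θ'.α (τ t) * Φ.U (t, x, u₀) ^ θ'.n * k
        = a * u₀ ^ n * κ + fderiv ℝ Φ.X (t, x, u₀) (1, 0, 0) ∧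
      θ'.β (τ t) * k = b * κ ^ 3 := by
  have main : ∀ q r : ℝ, (-(a * u₀ ^ n * q + 6 * b * r)
        - fderiv ℝ Φ.X (t, x, u₀) (1, 0, 0) * q * κ⁻¹)
      + θ'.α (τ t) * Φ.U (t, x, u₀) ^ θ'.n * k * q * κ⁻¹
      + 6 * (θ'.β (τ t) * k * r * κ⁻¹ ^ 3) = 0 := by
    intro q r
    set u := jetPoly t x u₀ 0 0 0 0 0 0 with hu
    -- The time slope compensates the linear and cubic terms. Since `q` and `r` are free, they give
    -- the relations for `α` and `β` separately.
    set w := jetPoly t x u₀ (-(a * u₀ ^ n * q + 6 * b * r)) 0 q r 0 0 with hw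
    obtain ⟨f, c, D, g, hf, hc, hcU, hg0, hg, hgX, -, hD, hfU, heq⟩ :=
      exists_jet_variation (u := u) (w := w) hΩ hz hΦ hu₀ hT hτ hk
        (by rw [hXx, hXu]; simpa using hκ) (by rw [hXx, hXu]; simpa using hκ) hu hw
    have hcN : c = N := (hcU hXu).trans hNU
    have hFF := eventually_alongGraph_eq (u := u) (w := w) (t := t) (x := x) hΩ hT hX
      (contDiffAt_graphMap (contDiff_jetPoly ..).contDiffAt).continuousAt
      (contDiffAt_graphMap (contDiff_jetPoly ..).contDiffAt).continuousAt
      (by rw [graphMap_jetPoly]; exact hz) (by rw [graphMap_jetPoly]; exact hz)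
    have hexp : (fun y => f (Φ.X (t, x, u₀) + y)
        - (N * q * κ⁻¹ * y + N * r * κ⁻¹ ^ 3 * y ^ 3 + 0 * y ^ 4 + 0 * y ^ 5)) =o[𝓝 0]
        (fun y : ℝ => y ^ 5) := by
      refine (Asymptotics.isLittleO_zero (fun y : ℝ => y ^ 5) (𝓝 0)).congr' ?_ EventuallyEq.rfl
      filter_upwards [hgX, hfU hFF] with y h1 h2
      have hgr : g y = x + κ⁻¹ * y := by
        have := h1.2.2
        rw [hXs _ _ h1.1] at this
        have h4 := inv_mul_cancel_left₀ hκ (g y - x)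
        rw [show κ * (g y - x) = y by linarith] at h4
        linarith
      have hwu : w t (g y) - u t (g y) = q * (κ⁻¹ * y) + r * (κ⁻¹ * y) ^ 3 := by
        rw [hgr, hu, hw]; simp only [jetPoly]; ring
      rw [h2, hU _ _ _ h1.2.1 h1.1, hwu]
      ring
    obtain ⟨h1, h3, h5⟩ := derivs_of_expansion hf hexp
    have e := heq a b s n θ' (by ring) (by ring) hmap
    rw [h1, hXu, hcN] at hD
    rw [h1, h3, h5] at e
    refine (mul_eq_zero.1 ?_).resolve_left hN
    linear_combination k * e - hD
  have h1 := main 1 0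
  have h2 := main 0 1
  have hκ1 : κ⁻¹ * κ = 1 := inv_mul_cancel₀ hκ
  constructor
  · linear_combination κ * h1 + (fderiv ℝ Φ.X (t, x, u₀) (1, 0, 0)
      - θ'.α (τ t) * Φ.U (t, x, u₀) ^ θ'.n * k) * hκ1
  · have hκ3 : κ⁻¹ ^ 3 * κ ^ 3 = 1 := by rw [← mul_pow, hκ1, one_pow]
    linear_combination (κ ^ 3 / 6) * h2 - θ'.β (τ t) * k * hκ3

/-- The new dependent variable depends on `u` only. -/
theorem fderiv_U_eq_zero {Φ : Transformation} {Ω : Set (ℝ × ℝ × ℝ)} {t x u₀ : ℝ}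
    (hΩ : IsOpen Ω) (hz : (t, x, u₀) ∈ Ω) (hΦ : RegularAt Φ (t, x, u₀)) (hu₀ : u₀ ≠ 0)
    {τ : ℝ → ℝ} (hT : ∀ z ∈ Ω, Φ.T z = τ z.1) {k : ℝ} (hτ : HasDerivAt τ k t) (hk : k ≠ 0)
    {κ : ℝ} (hκ : κ ≠ 0) (hXx : fderiv ℝ Φ.X (t, x, u₀) (0, 1, 0) = κ) (n : ℤ)
    (hmap : ∀ a b s : ℝ, a ≠ 0 → b ≠ 0 → s ≠ 0 → ∃ θ' : Elements,
      Φ.MapsEquation Ω ⟨fun _ => a, fun _ => b, fun _ => s, n⟩ θ' ∧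
      θ'.α (τ t) * Φ.U (t, x, u₀) ^ θ'.n * k
        = a * u₀ ^ n * κ + fderiv ℝ Φ.X (t, x, u₀) (1, 0, 0) ∧
      θ'.β (τ t) * k = b * κ ^ 3 ∧ θ'.σ (τ t) * k = s * κ ^ 5) :
    fderiv ℝ Φ.U (t, x, u₀) (1, 0, 0) = 0 ∧ fderiv ℝ Φ.U (t, x, u₀) (0, 1, 0) = 0 := by
  set u := jetPoly t x u₀ 0 0 0 0 0 0 with hu
  have hgu : graphMap u (t, x) = (t, x, u₀) := graphMap_jetPoly ..
  have hus : ContDiffAt ℝ ∞ (Function.uncurry u) (t, x) := (contDiff_jetPoly ..).contDiffAt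
  have hTf := fun v => fderiv_T_apply hΩ hz hT hτ v
  have hbij : Function.Bijective (fderiv ℝ (Φ.alongGraph u) (t, x)) := by
    refine bijective_of_jacobian_ne_zero hΦ ?_
    simp only [hTf, hXx]
    simpa using ⟨hk, hκ⟩
  obtain ⟨v, hv, hm⟩ := exists_mapsGraphAt (by rwa [hgu]) hus hbij
  have hζ : Φ.alongGraph u (t, x) = (τ t, Φ.X (t, x, u₀)) := by
    change (Φ.T (graphMap u (t, x)), Φ.X (graphMap u (t, x))) = _
    rw [hgu, hT _ hz]
  have hv' : ContDiffAt ℝ ∞ (Function.uncurry v) (τ t, Φ.X (t, x, u₀)) := by rwa [← hζ]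
  have hv0 : v (τ t) (Φ.X (t, x, u₀)) = Φ.U (t, x, u₀) := by
    have := hm.2.self_of_nhds
    rw [hζ] at this
    rw [this, ← hgu]; rfl
  set D := fderiv ℝ (Function.uncurry v) (τ t, Φ.X (t, x, u₀)) (1, 0) with hDdef
  set P := deriv (v (τ t)) (Φ.X (t, x, u₀)) with hPdef
  -- A constant solves every equation of the class, and its transform `v` is fixed before the
  -- coefficients are chosen. One function thus satisfies a whole family of relations; reversing `a`
  -- isolates `P`, and reversing all signs isolates `D`.
  have heq : ∀ a b s : ℝ, a ≠ 0 → b ≠ 0 → s ≠ 0 →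
      k * D + (a * u₀ ^ n * κ + fderiv ℝ Φ.X (t, x, u₀) (1, 0, 0)) * P
        + b * κ ^ 3 * iteratedDeriv 3 (v (τ t)) (Φ.X (t, x, u₀))
        + s * κ ^ 5 * iteratedDeriv 5 (v (τ t)) (Φ.X (t, x, u₀)) = 0 := by
    intro a b s ha hb hs
    obtain ⟨θ', hθ, e1, e2, e3⟩ := hmap a b s ha hb hs
    have h := (hθ u v t x (by simpa [u] using hz) hus hv hm).1
      (satisfiesAt_jetPoly t x 0 0 0 0 0 0 hu₀ (by ring))
    rw [hζ] at h
    have h2 := h.2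
    simp only [hv0] at h2
    rw [deriv_fst_eq_fderiv (hv'.differentiableAt (by simp))] at h2
    rw [← e1, ← e2, ← e3]
    linear_combination k * h2
  have hP : P = 0 := by
    have e1 := heq 1 1 1 (by norm_num) (by norm_num) (by norm_num)
    have e2 := heq (-1) 1 1 (by norm_num) (by norm_num) (by norm_num)
    have hne : 2 * (u₀ ^ n * κ) ≠ 0 :=
      mul_ne_zero two_ne_zero (mul_ne_zero (zpow_ne_zero _ hu₀) hκ)
    refine (mul_eq_zero.1 ?_).resolve_left hne
    linear_combination e1 - e2
  have hD : D = 0 := by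
    have e1 := heq 1 1 1 (by norm_num) (by norm_num) (by norm_num)
    have e2 := heq (-1) (-1) (-1) (by norm_num) (by norm_num) (by norm_num)
    refine (mul_eq_zero.1 ?_).resolve_left hk
    rw [hP] at e1 e2
    linear_combination (e1 + e2) / 2
  have hvd : HasFDerivAt (Function.uncurry v) (0 : ℝ × ℝ →L[ℝ] ℝ) (Φ.alongGraph u (t, x)) := by
    rw [hζ]
    have h1 : fderiv ℝ (Function.uncurry v) (τ t, Φ.X (t, x, u₀)) = 0 := by
      ext
      · exact hD
      · rw [hPdef, deriv_snd_eq_fderiv (hv'.differentiableAt (by simp))] at hP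
        exact hP
    rw [← h1]
    exact (hv'.differentiableAt (by simp)).hasFDerivAt
  have h1 := hvd.comp (t, x)
    ((contDiffAt_alongGraph (by rwa [hgu]) hus).differentiableAt (by simp)).hasFDerivAt
  have hUd : HasFDerivAt Φ.U (fderiv ℝ Φ.U (t, x, u₀)) (graphMap u (t, x)) := by
    rw [hgu]; exact (hΦ.smooth_U.differentiableAt (by simp)).hasFDerivAt
  have h2 := hUd.comp (t, x) (hasFDerivAt_graphMap hus)
  have h3 := h1.unique (h2.congr_of_eventuallyEq (by
    filter_upwards [hm.2] with y hy using hy))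
  have h4 : ∀ p : ℝ × ℝ, fderiv ℝ Φ.U (t, x, u₀) (p.1, p.2, 0) = 0 := by
    intro p
    have h5 := DFunLike.congr_fun h3 p
    have h6 : fderiv ℝ (Function.uncurry u) (t, x) p = 0 := by
      rw [hu, fderiv_jetPoly]; ring
    simp only [ContinuousLinearMap.comp_apply, ContinuousLinearMap.prod_apply, h6,
      zero_apply] at h5
    exact h5.symm
  exact ⟨h4 (1, 0), h4 (0, 1)⟩

/-! ### Nondegeneracy, extension across `u = 0`, and integration on slices. -/

theorem isOpen_coeffSpace : IsOpen coeffSpace := by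
  have h1 : IsOpen {c : ℝ × ℝ × ℝ | c.1 ≠ 0} := isOpen_ne_fun (by fun_prop) (by fun_prop)
  have h2 : IsOpen {c : ℝ × ℝ × ℝ | c.2.1 ≠ 0} := isOpen_ne_fun (by fun_prop) (by fun_prop)
  have h3 : IsOpen {c : ℝ × ℝ × ℝ | c.2.2 ≠ 0} := isOpen_ne_fun (by fun_prop) (by fun_prop)
  exact h1.inter (h2.inter h3)

/-- The extended Jacobian is block triangular because `T`, `X`, `U` do not involve the coefficients.
Its coefficient block is injective, hence surjective, so a kernel vector of the `(t, x, u)` block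
lifts to a kernel vector of the whole. -/
theorem IsUsualEquivalence.regularAt {E : Set ℤ} {Ω : Set (ℝ × ℝ × ℝ)} {Φ : Transformation}
    (h : IsUsualEquivalence E Ω Φ) (hΩ : IsOpen Ω) (hE : E.Nonempty) {z : ℝ × ℝ × ℝ}
    (hz : z ∈ Ω) : RegularAt Φ z := by
  obtain ⟨n, hn⟩ := hE
  let c : ℝ × ℝ × ℝ := (1, 1, 1)
  have hc : c ∈ coeffSpace := by simp [c, coeffSpace]
  have hcd : ContDiffAt ℝ ∞ (Φ.extended n) (z, c) :=
    (h.smooth n hn).contDiffAt ((hΩ.prod isOpen_coeffSpace).mem_nhds ⟨hz, hc⟩)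
  have hι : ContDiffAt ℝ ∞ (fun y : ℝ × ℝ × ℝ => (y, c)) z := contDiffAt_id.prodMk contDiffAt_const
  have hbase : ContDiffAt ℝ ∞ (fun y => (Φ.extended n (y, c)).1) z :=
    (ContDiffAt.comp (g := Φ.extended n) z hcd hι).fst
  have hT : ContDiffAt ℝ ∞ Φ.T z := hbase.fst
  have hX : ContDiffAt ℝ ∞ Φ.X z := hbase.snd.fst
  have hU : ContDiffAt ℝ ∞ Φ.U z := hbase.snd.snd
  refine ⟨hT, hX, hU, fun v hTv hXv hUv => ?_⟩
  set L := fderiv ℝ (Φ.extended n) (z, c)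
  have hL : HasFDerivAt (Φ.extended n) L (z, c) := (hcd.differentiableAt (by simp)).hasFDerivAt
  have hL1 : ∀ v w, (L (v, w)).1 = (fderiv ℝ Φ.T z v, fderiv ℝ Φ.X z v, fderiv ℝ Φ.U z v) := by
    intro v w
    have e1 : HasFDerivAt (fun p => (Φ.extended n p).1) _ (z, c) := hL.fst
    have e2 : HasFDerivAt (fun p : (ℝ × ℝ × ℝ) × (ℝ × ℝ × ℝ) => (Φ.T p.1, Φ.X p.1, Φ.U p.1)) _
        (z, c) :=
      HasFDerivAt.comp (g := fun y => (Φ.T y, Φ.X y, Φ.U y)) (z, c)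
        ((hT.differentiableAt (by simp)).hasFDerivAt.prodMk
          ((hX.differentiableAt (by simp)).hasFDerivAt.prodMk
            (hU.differentiableAt (by simp)).hasFDerivAt)) hasFDerivAt_fst
    exact DFunLike.congr_fun (e1.unique e2) (v, w)
  have hLinj := (h.nondegenerate n hn (z, c) ⟨hz, hc⟩).1
  let M : ℝ × ℝ × ℝ →ₗ[ℝ] ℝ × ℝ × ℝ :=
    { toFun := fun w => (L (0, w)).2
      map_add' := fun w w' => by
        rw [show ((0 : ℝ × ℝ × ℝ), w + w') = (0, w) + (0, w') by simp, map_add]; rfl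
      map_smul' := fun r w => by
        rw [show ((0 : ℝ × ℝ × ℝ), r • w) = r • ((0 : ℝ × ℝ × ℝ), w) by simp, map_smul]; rfl }
  have hM : Function.Injective M := by
    rw [← LinearMap.ker_eq_bot, LinearMap.ker_eq_bot']
    intro w hw
    have e : L (0, w) = L 0 := by
      rw [map_zero]
      refine Prod.ext ?_ hw
      rw [hL1]; simp
    exact (Prod.mk.inj (hLinj e)).2
  obtain ⟨w, hw⟩ := LinearMap.injective_iff_surjective.1 hM (-(L (v, 0)).2)
  have e : L (v, w) = L 0 := by
    rw [map_zero]
    refine Prod.ext ?_ ?_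
    · rw [hL1, hTv, hXv, hUv]; rfl
    · rw [show (v, w) = (v, 0) + ((0 : ℝ × ℝ × ℝ), w) by simp, map_add]
      change (L (v, 0)).2 + M w = 0
      rw [hw, add_neg_cancel]
  exact (Prod.mk.inj (hLinj e)).1

/-- Continuous equations extend across `u = 0`. -/
theorem eq_of_eq_off_zero {Ω : Set (ℝ × ℝ × ℝ)} (hΩ : IsOpen Ω) {g : ℝ × ℝ × ℝ → ℝ} {c t x u : ℝ}
    (hg : ContinuousAt g (t, x, u)) (hz : (t, x, u) ∈ Ω)
    (h : ∀ v, (t, x, v) ∈ Ω → v ≠ 0 → g (t, x, v) = c) : g (t, x, u) = c := by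
  have h1 : Tendsto (fun v : ℝ => (t, x, v)) (𝓝[≠] u) (𝓝 (t, x, u)) := by
    have : Continuous fun v : ℝ => (t, x, v) := by fun_prop
    exact (this.tendsto u).mono_left nhdsWithin_le_nhds
  have h2 : ∀ᶠ v in 𝓝[≠] u, v ≠ 0 := by
    by_cases hu : u = 0
    · rw [hu]; exact self_mem_nhdsWithin
    · exact nhdsWithin_le_nhds (isOpen_ne.mem_nhds hu)
  refine tendsto_nhds_unique (hg.tendsto.comp h1) (tendsto_const_nhds.congr' ?_)
  filter_upwards [h1.eventually (hΩ.mem_nhds hz), h2] with v hv hv0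
  exact (h v hv hv0).symm

theorem exists_off_zero {Ω : Set (ℝ × ℝ × ℝ)} (hΩ : IsOpen Ω) {t x u : ℝ}
    (hz : (t, x, u) ∈ Ω) : ∃ v, (t, x, v) ∈ Ω ∧ v ≠ 0 := by
  by_contra! hcon
  have := eq_of_eq_off_zero (g := fun _ => 0) (c := 1) hΩ continuousAt_const hz
    fun v hv hv0 => absurd (hcon v hv) hv0
  norm_num at this

section Smooth

variable {Ω : Set (ℝ × ℝ × ℝ)} {f : ℝ × ℝ × ℝ → ℝ}

theorem contDiffAt_fderiv_apply {z : ℝ × ℝ × ℝ} (hf : ContDiffAt ℝ ∞ f z) (e : ℝ × ℝ × ℝ) :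
    ContDiffAt ℝ ∞ (fun y => fderiv ℝ f y e) z :=
  (hf.fderiv_right (m := ∞) (by simp)).clm_apply contDiffAt_const

/-- Mixed second derivatives vanish with the first derivative in one of the directions. -/
theorem mixed_fderiv_eq_zero (hΩ : IsOpen Ω) (hf : ∀ z ∈ Ω, ContDiffAt ℝ ∞ f z)
    {v : ℝ × ℝ × ℝ} (h : ∀ z ∈ Ω, fderiv ℝ f z v = 0) (e : ℝ × ℝ × ℝ) {z : ℝ × ℝ × ℝ}
    (hz : z ∈ Ω) : fderiv ℝ (fun y => fderiv ℝ f y e) z v = 0 := by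
  have hd : DifferentiableAt ℝ (fderiv ℝ f) z :=
    ((hf z hz).fderiv_right (m := ∞) (by simp)).differentiableAt (by simp)
  have happ : ∀ e v, fderiv ℝ (fun y => fderiv ℝ f y e) z v = fderiv ℝ (fderiv ℝ f) z v e := by
    intro e v
    have := (hd.hasFDerivAt.clm_apply (hasFDerivAt_const e z))
    rw [this.fderiv]; simp
  have hs : IsSymmSndFDerivAt ℝ f z := (hf z hz).isSymmSndFDerivAt (by
    rw [minSmoothness_of_isRCLikeNormedField]; exact natCast_le_infty 2)
  rw [happ, hs.eq, ← happ]
  have : (fun y => fderiv ℝ f y v) =ᶠ[𝓝 z] fun _ => (0 : ℝ) := by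
    filter_upwards [hΩ.mem_nhds hz] with y hy using h y hy
  rw [this.fderiv_eq]; simp

theorem eq_of_fderiv_eq_zero (hconv : Convex ℝ Ω) (hf : ∀ z ∈ Ω, ContDiffAt ℝ ∞ f z)
    (h₁ : ∀ z ∈ Ω, fderiv ℝ f z (1, 0, 0) = 0) (h₂ : ∀ z ∈ Ω, fderiv ℝ f z (0, 1, 0) = 0)
    (h₃ : ∀ z ∈ Ω, fderiv ℝ f z (0, 0, 1) = 0) {z z' : ℝ × ℝ × ℝ} (hz : z ∈ Ω) (hz' : z' ∈ Ω) :
    f z' = f z := by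
  refine eq_of_fderiv_displacement hconv (fun y hy => (hf y hy).differentiableAt (by simp)) hz hz'
    fun y hy => ?_
  rw [map_triple _ (z' - z).1 (z' - z).2.1 (z' - z).2.2, h₁ y hy, h₂ y hy, h₃ y hy]
  ring

theorem eq_of_fderiv_slice (hconv : Convex ℝ Ω) (hf : ∀ z ∈ Ω, ContDiffAt ℝ ∞ f z) {t : ℝ}
    (h₂ : ∀ x u, (t, x, u) ∈ Ω → fderiv ℝ f (t, x, u) (0, 1, 0) = 0)
    (h₃ : ∀ x u, (t, x, u) ∈ Ω → fderiv ℝ f (t, x, u) (0, 0, 1) = 0)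
    {x u x' u' : ℝ} (hz : (t, x, u) ∈ Ω) (hz' : (t, x', u') ∈ Ω) :
    f (t, x', u') = f (t, x, u) := by
  have hconv' : Convex ℝ (Ω ∩ {z | z.1 = t}) :=
    hconv.inter ((convex_singleton t).linear_preimage (LinearMap.fst ℝ ℝ (ℝ × ℝ)))
  refine eq_of_fderiv_displacement hconv' (fun y hy => (hf y hy.1).differentiableAt (by simp))
    ⟨hz, rfl⟩ ⟨hz', rfl⟩ fun y hy => ?_
  obtain ⟨y₁, y₂, y₃⟩ := y
  obtain ⟨hy, rfl⟩ := hy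
  change fderiv ℝ f _ (y₁ - y₁, x' - x, u' - u) = 0
  rw [map_triple, h₂ _ _ hy, h₃ _ _ hy]
  ring

theorem eq_of_fderiv_line (hconv : Convex ℝ Ω) (hf : ∀ z ∈ Ω, ContDiffAt ℝ ∞ f z)
    {t x : ℝ} (h₃ : ∀ u, (t, x, u) ∈ Ω → fderiv ℝ f (t, x, u) (0, 0, 1) = 0) {u u' : ℝ}
    (hz : (t, x, u) ∈ Ω) (hz' : (t, x, u') ∈ Ω) : f (t, x, u') = f (t, x, u) := by
  have hconv' : Convex ℝ (Ω ∩ ({z | z.1 = t} ∩ {z | z.2.1 = x})) :=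
    hconv.inter (((convex_singleton t).linear_preimage (LinearMap.fst ℝ ℝ (ℝ × ℝ))).inter
      ((convex_singleton x).linear_preimage
        (LinearMap.fst ℝ ℝ ℝ ∘ₗ LinearMap.snd ℝ ℝ (ℝ × ℝ))))
  refine eq_of_fderiv_displacement hconv' (fun y hy => (hf y hy.1).differentiableAt (by simp))
    ⟨hz, rfl, rfl⟩ ⟨hz', rfl, rfl⟩ fun y hy => ?_
  obtain ⟨y₁, y₂, y₃⟩ := y
  obtain ⟨hy, rfl, rfl⟩ := hy
  change fderiv ℝ f _ (y₁ - y₁, y₂ - y₂, u' - u) = 0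
  rw [map_triple, h₃ _ hy]
  ring

end Smooth

section TimeComponent

variable {Φ : Transformation} {Ω : Set (ℝ × ℝ × ℝ)}

theorem exists_time_function (hΩ : IsOpen Ω) (hconv : Convex ℝ Ω)
    (hreg : ∀ z ∈ Ω, RegularAt Φ z) (hx : ∀ z ∈ Ω, fderiv ℝ Φ.T z (0, 1, 0) = 0)
    (hu : ∀ z ∈ Ω, fderiv ℝ Φ.T z (0, 0, 1) = 0) :
    ∃ τ : ℝ → ℝ, ContDiffOn ℝ ∞ τ (Prod.fst '' Ω) ∧ (∀ z ∈ Ω, Φ.T z = τ z.1) ∧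
      ∀ t ∈ Prod.fst '' Ω, deriv τ t ≠ 0 ∧ HasDerivAt τ (deriv τ t) t := by
  classical
  have hslice : ∀ z ∈ Ω, ∀ z' ∈ Ω, z'.1 = z.1 → Φ.T z' = Φ.T z := by
    rintro ⟨t, x, u⟩ hz ⟨t', x', u'⟩ hz' (rfl : t' = t)
    exact eq_of_fderiv_slice hconv (fun z hz => (hreg z hz).smooth_T)
      (fun _ _ h => hx _ h) (fun _ _ h => hu _ h) hz hz'
  -- The chosen point is immaterial since `T` is constant on the convex slices of fixed `t`; the
  -- value `0` off the projection is never used.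
  let τ : ℝ → ℝ := fun t => if h : ∃ z ∈ Ω, z.1 = t then Φ.T h.choose else 0
  have hT : ∀ z ∈ Ω, Φ.T z = τ z.1 := by
    intro z hz
    have h : ∃ z' ∈ Ω, z'.1 = z.1 := ⟨z, hz, rfl⟩
    simp only [τ, dif_pos h]
    exact hslice _ h.choose_spec.1 _ hz h.choose_spec.2.symm
  have hloc : ∀ z ∈ Ω, τ =ᶠ[𝓝 z.1] fun t => Φ.T (t, z.2) := by
    intro z hz
    have hc : ContinuousAt (fun t : ℝ => (t, z.2)) z.1 := by fun_prop
    filter_upwards [hc.eventually_mem (hΩ.mem_nhds hz)] with t ht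
    exact (hT _ ht).symm
  have hsm : ∀ z ∈ Ω, ContDiffAt ℝ ∞ τ z.1 := by
    intro z hz
    refine ContDiffAt.congr_of_eventuallyEq ?_ (hloc z hz)
    exact ContDiffAt.comp (g := Φ.T) (f := fun t : ℝ => (t, z.2)) z.1 (hreg z hz).smooth_T
      (contDiffAt_id.prodMk contDiffAt_const)
  refine ⟨τ, ?_, hT, ?_⟩
  · rintro _ ⟨z, hz, rfl⟩
    exact (hsm z hz).contDiffWithinAt
  · rintro _ ⟨z, hz, rfl⟩
    have hd := ((hsm z hz).differentiableAt (by simp)).hasDerivAt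
    refine ⟨fun h0 => ?_, hd⟩
    have hTf := fun v => fderiv_T_apply hΩ hz hT hd v
    have hni : ¬ Function.Injective
        ((fderiv ℝ Φ.X z).prod (fderiv ℝ Φ.U z) : ℝ × ℝ × ℝ →ₗ[ℝ] ℝ × ℝ) := by
      intro hinj
      have := LinearMap.finrank_le_finrank_of_injective hinj
      simp at this
    apply hni
    rw [← LinearMap.ker_eq_bot, LinearMap.ker_eq_bot']
    intro p hp
    have hp' : (fderiv ℝ Φ.X z p, fderiv ℝ Φ.U z p) = ((0, 0) : ℝ × ℝ) := hp
    obtain ⟨hp1, hp2⟩ := Prod.mk.inj hp'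
    exact (hreg z hz).injective p (by rw [hTf, h0, zero_mul]) hp1 hp2

end TimeComponent

theorem extend_eq_zero {Ω : Set (ℝ × ℝ × ℝ)} (hΩ : IsOpen Ω) {f : ℝ × ℝ × ℝ → ℝ}
    (hf : ∀ z ∈ Ω, ContDiffAt ℝ ∞ f z)
    (h : ∀ t x u, (t, x, u) ∈ Ω → u ≠ 0 → f (t, x, u) = 0) : ∀ z ∈ Ω, f z = 0 := by
  rintro ⟨t, x, u⟩ hz
  exact eq_of_eq_off_zero hΩ (hf _ hz).continuousAt hz fun v hv hv0 => h t x v hv hv0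

/-! ### Necessity of the asserted form. -/

/-- A transformation in the usual equivalence group has the asserted form. -/
theorem IsUsualEquivalence.form {E : Set ℤ} (hE : E.Nonempty) (hE0 : (0 : ℤ) ∉ E)
    {Ω : Set (ℝ × ℝ × ℝ)} (hΩ : IsOpen Ω) (hconv : Convex ℝ Ω) (hne : Ω.Nonempty)
    {Φ : Transformation} (h : IsUsualEquivalence E Ω Φ) :
    ∃ (τ : ℝ → ℝ) (δ₁ δ₂ δ₃ : ℝ),
      ContDiffOn ℝ ∞ τ (Prod.fst '' Ω) ∧
      (∀ t ∈ Prod.fst '' Ω, deriv τ t ≠ 0) ∧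
      δ₁ ≠ 0 ∧ δ₃ ≠ 0 ∧
      (∀ t x u : ℝ, (t, x, u) ∈ Ω →
        Φ.T (t, x, u) = τ t ∧
        Φ.X (t, x, u) = δ₁ * x + δ₂ ∧
        Φ.U (t, x, u) = δ₃ * u) ∧
      (∀ t x u : ℝ, (t, x, u) ∈ Ω →
        ∀ a b s : ℝ, a ≠ 0 → b ≠ 0 → s ≠ 0 → ∀ n ∈ E,
          Φ.A (t, x, u) (a, b, s) n = δ₁ / (δ₃ ^ n * deriv τ t) * a ∧
          Φ.B (t, x, u) (a, b, s) n = δ₁ ^ 3 / deriv τ t * b ∧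
          Φ.S (t, x, u) (a, b, s) n = δ₁ ^ 5 / deriv τ t * s ∧
          Φ.N (t, x, u) (a, b, s) n = n) := by
  have hreg : ∀ z ∈ Ω, RegularAt Φ z := fun z hz => h.regularAt hΩ hE hz
  obtain ⟨n₀, hn₀⟩ := id hE
  have hmap : ∀ a b s : ℝ, a ≠ 0 → b ≠ 0 → s ≠ 0 → ∀ n ∈ E, ∃ θ' : Elements,
      InClass E (Φ.T '' Ω) θ' ∧
      (∀ z ∈ Ω, θ'.α (Φ.T z) = Φ.A z (a, b, s) n ∧ θ'.β (Φ.T z) = Φ.B z (a, b, s) n ∧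
        θ'.σ (Φ.T z) = Φ.S z (a, b, s) n ∧ θ'.n = Φ.N z (a, b, s) n) ∧
      Φ.MapsEquation Ω ⟨fun _ => a, fun _ => b, fun _ => s, n⟩ θ' := fun a b s ha hb hs n hn =>
    h.maps_class ⟨fun _ => a, fun _ => b, fun _ => s, n⟩
      ⟨contDiffOn_const, contDiffOn_const, contDiffOn_const, fun _ _ => ha, fun _ _ => hb,
        fun _ _ => hs, hn⟩
  obtain ⟨θ₀, hθ₀, -, hm₀⟩ := hmap 1 1 1 one_ne_zero one_ne_zero one_ne_zero n₀ hn₀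
  have hT' : ∀ t x u, (t, x, u) ∈ Ω → u ≠ 0 →
      fderiv ℝ Φ.T (t, x, u) (0, 1, 0) = 0 ∧ fderiv ℝ Φ.T (t, x, u) (0, 0, 1) = 0 :=
    fun t x u hz hu => fderiv_T_eq_zero (hreg _ hz) hz hu one_ne_zero hm₀
      (hθ₀.σ_ne_zero _ ⟨_, hz, rfl⟩)
  obtain ⟨τ, hτs, hT, hτ⟩ := exists_time_function hΩ hconv hreg
    (extend_eq_zero hΩ (fun z hz => contDiffAt_fderiv_apply (hreg z hz).smooth_T _)
      fun t x u hz hu => (hT' t x u hz hu).1)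
    (extend_eq_zero hΩ (fun z hz => contDiffAt_fderiv_apply (hreg z hz).smooth_T _)
      fun t x u hz hu => (hT' t x u hz hu).2)
  have hk : ∀ {t x u}, (t, x, u) ∈ Ω → deriv τ t ≠ 0 := fun hz => (hτ _ ⟨_, hz, rfl⟩).1
  have hτd : ∀ {t x u}, (t, x, u) ∈ Ω → HasDerivAt τ (deriv τ t) t :=
    fun hz => (hτ _ ⟨_, hz, rfl⟩).2
  -- the space component
  have hX' : ∀ t x u, (t, x, u) ∈ Ω → u ≠ 0 → fderiv ℝ Φ.X (t, x, u) (0, 0, 1) = 0 ∧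
      fderiv ℝ Φ.X (t, x, u) (0, 1, 0) ≠ 0 ∧ fderiv ℝ Φ.U (t, x, u) (0, 0, 1) ≠ 0 ∧
      ∀ a b s : ℝ, s ≠ 0 → ∀ (n : ℤ) (θ' : Elements),
        Φ.MapsEquation Ω ⟨fun _ => a, fun _ => b, fun _ => s, n⟩ θ' →
        θ'.σ (τ t) * deriv τ t = s * fderiv ℝ Φ.X (t, x, u) (0, 1, 0) ^ 5 := by
    intro t x u hz hu
    obtain ⟨e1, e2, e3, -⟩ :=
      fderiv_X_eq_zero hΩ hz (hreg _ hz) hu hT (hτd hz) (hk hz) one_ne_zero hm₀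
    exact ⟨e1, e2, e3, fun a b s hs n θ' hm =>
      (fderiv_X_eq_zero hΩ hz (hreg _ hz) hu hT (hτd hz) (hk hz) hs hm).2.2.2⟩
  have hXu : ∀ z ∈ Ω, fderiv ℝ Φ.X z (0, 0, 1) = 0 :=
    extend_eq_zero hΩ (fun z hz => contDiffAt_fderiv_apply (hreg z hz).smooth_X _)
      fun t x u hz hu => (hX' t x u hz hu).1
  have hXind : ∀ z ∈ Ω, ∀ z' ∈ Ω, z.1 = z'.1 → z.2.1 = z'.2.1 → Φ.X z = Φ.X z' := by
    rintro ⟨t, x, u⟩ hz ⟨t', x', u'⟩ hz' (rfl : t = t') (rfl : x = x')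
    exact eq_of_fderiv_line hconv (fun z hz => (hreg z hz).smooth_X) (fun u h => hXu _ h) hz' hz
  have hXx : ∀ t x u x' u', (t, x, u) ∈ Ω → u ≠ 0 → (t, x', u') ∈ Ω →
      fderiv ℝ Φ.X (t, x', u') (0, 1, 0) = fderiv ℝ Φ.X (t, x, u) (0, 1, 0) := by
    intro t x u x' u' hz hu hz'
    refine eq_of_eq_off_zero (g := fun z => fderiv ℝ Φ.X z (0, 1, 0)) hΩ
      (contDiffAt_fderiv_apply (hreg _ hz').smooth_X _).continuousAt hz' fun v hv hv0 => ?_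
    have e1 := (hX' t x u hz hu).2.2.2 1 1 1 one_ne_zero n₀ θ₀ hm₀
    have e2 := (hX' t x' v hv hv0).2.2.2 1 1 1 one_ne_zero n₀ θ₀ hm₀
    -- The fifth powers agree, since both equal `σ' T_t` at the same `t` with `s = 1`; an odd power
    -- is injective on the reals.
    have hodd : Odd 5 := by decide
    exact hodd.strictMono_pow.injective (by linarith)
  have hXs : ∀ t x u, (t, x, u) ∈ Ω → u ≠ 0 → ∀ y v, (t, y, v) ∈ Ω →
      Φ.X (t, y, v) = Φ.X (t, x, u) + fderiv ℝ Φ.X (t, x, u) (0, 1, 0) * (y - x) := by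
    intro t x u hz hu y v hv
    have hl : ∀ z : ℝ × ℝ × ℝ, HasFDerivAt
        (fun z : ℝ × ℝ × ℝ => fderiv ℝ Φ.X (t, x, u) (0, 1, 0) * z.2.1)
        (fderiv ℝ Φ.X (t, x, u) (0, 1, 0) •
          ((ContinuousLinearMap.fst ℝ ℝ ℝ).comp (ContinuousLinearMap.snd ℝ ℝ (ℝ × ℝ)))) z :=
      fun z => ((hasFDerivAt_fst).comp z hasFDerivAt_snd).const_mul _
    have hfd : ∀ z ∈ Ω, ∀ e : ℝ × ℝ × ℝ,
        fderiv ℝ (fun z : ℝ × ℝ × ℝ => Φ.X z - fderiv ℝ Φ.X (t, x, u) (0, 1, 0) * z.2.1) z e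
          = fderiv ℝ Φ.X z e - fderiv ℝ Φ.X (t, x, u) (0, 1, 0) * e.2.1 := by
      intro z hz e
      have := (((hreg z hz).smooth_X.differentiableAt (by simp)).hasFDerivAt.sub (hl z)).fderiv
      have h2 := DFunLike.congr_fun this e
      exact h2
    have := eq_of_fderiv_slice (t := t) hconv
      (f := fun z : ℝ × ℝ × ℝ => Φ.X z - fderiv ℝ Φ.X (t, x, u) (0, 1, 0) * z.2.1)
      (fun z hz => (hreg z hz).smooth_X.sub (by fun_prop))
      (fun y v hy => by rw [hfd _ hy, hXx t x u y v hz hu hy]; ring)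
      (fun y v hy => by rw [hfd _ hy, hXu _ hy]; ring) hz hv
    simp only at this
    linear_combination this
  -- the dependent variable
  have hUsm : ∀ z ∈ Ω, ContDiffAt ℝ ∞ (fun y => fderiv ℝ Φ.U y (0, 0, 1)) z :=
    fun z hz => contDiffAt_fderiv_apply (hreg z hz).smooth_U _
  have hslope : ∀ t x u, (t, x, u) ∈ Ω → u ≠ 0 → ∀ q : ℝ,
      fderiv ℝ (fun z => fderiv ℝ Φ.U z (0, 0, 1)) (t, x, u) (0, 1, q) = 0 :=
    fun t x u hz hu q => fderiv_U_slope_eq_zero hΩ hz (hreg _ hz) hu hT (hτd hz) (hk hz) hXind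
      (hX' t x u hz hu).2.1 (hXs t x u hz hu) rfl (hXu _ hz) hm₀
      (by rw [← hT _ hz]; exact hθ₀.σ_ne_zero _ ⟨_, hz, rfl⟩) q
  have hUux : ∀ z ∈ Ω, fderiv ℝ (fun z => fderiv ℝ Φ.U z (0, 0, 1)) z (0, 1, 0) = 0 :=
    extend_eq_zero hΩ (fun z hz => contDiffAt_fderiv_apply (hUsm z hz) _)
      fun t x u hz hu => hslope t x u hz hu 0
  have hUuu : ∀ z ∈ Ω, fderiv ℝ (fun z => fderiv ℝ Φ.U z (0, 0, 1)) z (0, 0, 1) = 0 :=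
    extend_eq_zero hΩ (fun z hz => contDiffAt_fderiv_apply (hUsm z hz) _)
      fun t x u hz hu => by
        have e1 := hslope t x u hz hu 1
        have e0 := hslope t x u hz hu 0
        rw [map_triple] at e1 e0 ⊢
        linear_combination e1 - e0
  have hUlin : ∀ N : ℝ, (∀ z ∈ Ω, ∀ e : ℝ × ℝ × ℝ,
      fderiv ℝ (fun z : ℝ × ℝ × ℝ => Φ.U z - N * z.2.2) z e
        = fderiv ℝ Φ.U z e - N * e.2.2) := by
    intro N z hz e
    have hl : HasFDerivAt (fun z : ℝ × ℝ × ℝ => N * z.2.2)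
        (N • ((ContinuousLinearMap.snd ℝ ℝ ℝ).comp (ContinuousLinearMap.snd ℝ ℝ (ℝ × ℝ)))) z :=
      ((hasFDerivAt_snd).comp z hasFDerivAt_snd).const_mul _
    have := (((hreg z hz).smooth_U.differentiableAt (by simp)).hasFDerivAt.sub hl).fderiv
    exact DFunLike.congr_fun this e
  have hUs : ∀ t x u, (t, x, u) ∈ Ω → ∀ y v v', (t, y, v) ∈ Ω → (t, y, v') ∈ Ω →
      Φ.U (t, y, v') - Φ.U (t, y, v) = fderiv ℝ Φ.U (t, x, u) (0, 0, 1) * (v' - v) := by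
    intro t x u hz y v v' hv hv'
    have hc : ∀ w, (t, y, w) ∈ Ω →
        fderiv ℝ Φ.U (t, y, w) (0, 0, 1) = fderiv ℝ Φ.U (t, x, u) (0, 0, 1) := fun w hw =>
      eq_of_fderiv_slice (f := fun z => fderiv ℝ Φ.U z (0, 0, 1)) hconv hUsm
        (fun x u h => hUux _ h) (fun x u h => hUuu _ h) hz hw
    have := eq_of_fderiv_line (t := t) (x := y) hconv
      (f := fun z : ℝ × ℝ × ℝ => Φ.U z - fderiv ℝ Φ.U (t, x, u) (0, 0, 1) * z.2.2)
      (fun z hz => (hreg z hz).smooth_U.sub (by fun_prop))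
      (fun w hw => by rw [hUlin _ _ hw, hc w hw]; ring) hv hv'
    simp only at this
    linear_combination this
  have hrel : ∀ t x u, (t, x, u) ∈ Ω → u ≠ 0 → ∀ (a b s : ℝ) (n : ℤ) (θ' : Elements),
      Φ.MapsEquation Ω ⟨fun _ => a, fun _ => b, fun _ => s, n⟩ θ' →
      θ'.α (τ t) * Φ.U (t, x, u) ^ θ'.n * deriv τ t
        = a * u ^ n * fderiv ℝ Φ.X (t, x, u) (0, 1, 0) + fderiv ℝ Φ.X (t, x, u) (1, 0, 0) ∧
      θ'.β (τ t) * deriv τ t = b * fderiv ℝ Φ.X (t, x, u) (0, 1, 0) ^ 3 :=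
    fun t x u hz hu a b s n θ' hm => alpha_beta_relation hΩ hz (hreg _ hz) hu hT (hτd hz) (hk hz)
      hXind (hX' t x u hz hu).2.1 (hXs t x u hz hu) rfl (hXu _ hz) (hX' t x u hz hu).2.2.1 rfl
      (hUs t x u hz) hm
  have hUtx : ∀ t x u, (t, x, u) ∈ Ω → u ≠ 0 →
      fderiv ℝ Φ.U (t, x, u) (1, 0, 0) = 0 ∧ fderiv ℝ Φ.U (t, x, u) (0, 1, 0) = 0 :=
    fun t x u hz hu => fderiv_U_eq_zero hΩ hz (hreg _ hz) hu hT (hτd hz) (hk hz)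
      (hX' t x u hz hu).2.1 rfl n₀ fun a b s ha hb hs => by
        obtain ⟨θ', -, -, hm⟩ := hmap a b s ha hb hs n₀ hn₀
        exact ⟨θ', hm, (hrel t x u hz hu a b s n₀ θ' hm).1, (hrel t x u hz hu a b s n₀ θ' hm).2,
          (hX' t x u hz hu).2.2.2 a b s hs n₀ θ' hm⟩
  have hUt : ∀ z ∈ Ω, fderiv ℝ Φ.U z (1, 0, 0) = 0 :=
    extend_eq_zero hΩ (fun z hz => contDiffAt_fderiv_apply (hreg z hz).smooth_U _)
      fun t x u hz hu => (hUtx t x u hz hu).1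
  have hUx : ∀ z ∈ Ω, fderiv ℝ Φ.U z (0, 1, 0) = 0 :=
    extend_eq_zero hΩ (fun z hz => contDiffAt_fderiv_apply (hreg z hz).smooth_U _)
      fun t x u hz hu => (hUtx t x u hz hu).2
  obtain ⟨⟨t₀, x₀, u₀'⟩, hz₀'⟩ := hne
  obtain ⟨u₀, hz₀, hu₀⟩ := exists_off_zero hΩ hz₀'
  set δ₃ := fderiv ℝ Φ.U (t₀, x₀, u₀) (0, 0, 1) with hδ₃
  have hδ₃0 : δ₃ ≠ 0 := (hX' _ _ _ hz₀ hu₀).2.2.1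
  have hUu : ∀ z ∈ Ω, fderiv ℝ Φ.U z (0, 0, 1) = δ₃ := fun z hz =>
    eq_of_fderiv_eq_zero (f := fun z => fderiv ℝ Φ.U z (0, 0, 1)) hconv hUsm
      (fun z hz => mixed_fderiv_eq_zero hΩ (fun z hz => (hreg z hz).smooth_U) hUt _ hz)
      hUux hUuu hz₀ hz
  have hUaff : ∀ z ∈ Ω, Φ.U z = δ₃ * z.2.2 + (Φ.U (t₀, x₀, u₀) - δ₃ * u₀) := by
    intro z hz
    have := eq_of_fderiv_eq_zero hconv (f := fun z : ℝ × ℝ × ℝ => Φ.U z - δ₃ * z.2.2)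
      (fun z hz => (hreg z hz).smooth_U.sub (by fun_prop))
      (fun z hz => by rw [hUlin _ _ hz, hUt z hz]; ring)
      (fun z hz => by rw [hUlin _ _ hz, hUx z hz]; ring)
      (fun z hz => by rw [hUlin _ _ hz, hUu z hz]; ring) hz₀ hz
    simp only at this
    linear_combination this
  set δ₀ := Φ.U (t₀, x₀, u₀) - δ₃ * u₀ with hδ₀
  -- homogeneity
  have hrig : ∀ t x u, (t, x, u) ∈ Ω → u ≠ 0 → ∀ (a b s : ℝ), a ≠ 0 → ∀ n ∈ E, ∀ θ' : Elements,
      Φ.MapsEquation Ω ⟨fun _ => a, fun _ => b, fun _ => s, n⟩ θ' →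
      θ'.n = n ∧
        (θ'.α (τ t) * deriv τ t) * δ₃ ^ n = a * fderiv ℝ Φ.X (t, x, u) (0, 1, 0) ∧
        (n ≠ 1 → δ₀ = 0 ∧ fderiv ℝ Φ.X (t, x, u) (1, 0, 0) = 0) ∧
        (n = 1 → fderiv ℝ Φ.X (t, x, u) (1, 0, 0) = (θ'.α (τ t) * deriv τ t) * δ₀) := by
    intro t x u hz hu a b s ha n hn θ' hm
    have hI : IsOpen {v : ℝ | (t, x, v) ∈ Ω ∧ v ≠ 0} := by
      have h1 : IsOpen ((fun v : ℝ => (t, x, v)) ⁻¹' Ω) :=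
        hΩ.preimage (by fun_prop)
      exact h1.inter isOpen_ne
    refine zpow_affine_rigidity hI ⟨u, hz, hu⟩ (mul_ne_zero ha (hX' t x u hz hu).2.1) hδ₃0
      (fun h0 => hE0 (h0 ▸ hn)) (fun v hv => hv.2) ?_
    rintro v ⟨hv, hv0⟩
    have e1 := (hrel t x v hv hv0 a b s n θ' hm).1
    have e2 : fderiv ℝ Φ.X (t, x, v) (1, 0, 0) = fderiv ℝ Φ.X (t, x, u) (1, 0, 0) :=
      eq_of_fderiv_line (f := fun z => fderiv ℝ Φ.X z (1, 0, 0)) hconv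
        (fun z hz => contDiffAt_fderiv_apply (hreg z hz).smooth_X _)
        (fun u h => mixed_fderiv_eq_zero hΩ (fun z hz => (hreg z hz).smooth_X) hXu _ h) hz hv
    rw [hUaff _ hv, e2, hXx t x u x v hz hu hv] at e1
    linear_combination e1
  have hzero : ∀ t x u, (t, x, u) ∈ Ω → u ≠ 0 →
      δ₀ = 0 ∧ fderiv ℝ Φ.X (t, x, u) (1, 0, 0) = 0 := by
    intro t x u hz hu
    -- For `n₀ = 1` homogeneity is not automatic: `X_t` equals `α' T_t δ₀`. Reversing the sign of
    -- `α` reverses `α' T_t` but not `X_t`, so both `X_t` and `δ₀` vanish.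
    obtain ⟨θ₁, -, -, hm₁⟩ :=
      hmap (-1) 1 1 (by norm_num) one_ne_zero one_ne_zero n₀ hn₀
    obtain ⟨-, e1, e2, e3⟩ := hrig t x u hz hu 1 1 1 one_ne_zero n₀ hn₀ θ₀ hm₀
    obtain ⟨-, f1, -, f3⟩ := hrig t x u hz hu (-1) 1 1 (by norm_num) n₀ hn₀ θ₁ hm₁
    by_cases hn : n₀ = 1
    · have e4 := e3 hn
      have f4 := f3 hn
      rw [hn, zpow_one] at e1 f1
      have hXt : fderiv ℝ Φ.X (t, x, u) (1, 0, 0) = 0 := by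
        refine (mul_eq_zero.1 ?_).resolve_left (mul_ne_zero two_ne_zero hδ₃0)
        linear_combination δ₃ * e4 + δ₃ * f4 + δ₀ * e1 + δ₀ * f1
      refine ⟨?_, hXt⟩
      rw [hXt] at e4
      refine (mul_eq_zero.1 ?_).resolve_left (hX' t x u hz hu).2.1
      linear_combination -δ₀ * e1 - δ₃ * e4
    · exact e2 hn
  have hδ₀0 : δ₀ = 0 := (hzero _ _ _ hz₀ hu₀).1
  have hXt : ∀ z ∈ Ω, fderiv ℝ Φ.X z (1, 0, 0) = 0 :=
    extend_eq_zero hΩ (fun z hz => contDiffAt_fderiv_apply (hreg z hz).smooth_X _)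
      fun t x u hz hu => (hzero t x u hz hu).2
  have hXxsm : ∀ z ∈ Ω, ContDiffAt ℝ ∞ (fun y => fderiv ℝ Φ.X y (0, 1, 0)) z :=
    fun z hz => contDiffAt_fderiv_apply (hreg z hz).smooth_X _
  have hXxx : ∀ z ∈ Ω, fderiv ℝ (fun y => fderiv ℝ Φ.X y (0, 1, 0)) z (0, 1, 0) = 0 := by
    refine extend_eq_zero hΩ (fun z hz => contDiffAt_fderiv_apply (hXxsm z hz) _)
      fun t x u hz hu => ?_
    have hl : HasDerivAt (fun y : ℝ => (t, y, u)) ((0, 1, 0) : ℝ × ℝ × ℝ) x :=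
      (hasDerivAt_const x t).prodMk ((hasDerivAt_id x).prodMk (hasDerivAt_const x u))
    have h1 := ((hXxsm _ hz).differentiableAt (by simp)).hasFDerivAt.comp_hasDerivAt x hl
    refine h1.unique ((hasDerivAt_const x (fderiv ℝ Φ.X (t, x, u) (0, 1, 0))).congr_of_eventuallyEq
      ?_)
    filter_upwards [hl.continuousAt.eventually_mem (hΩ.mem_nhds hz)] with y hy
    exact hXx t x u y u hz hu hy
  set δ₁ := fderiv ℝ Φ.X (t₀, x₀, u₀) (0, 1, 0) with hδ₁
  have hδ₁0 : δ₁ ≠ 0 := (hX' _ _ _ hz₀ hu₀).2.1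
  have hXxc : ∀ z ∈ Ω, fderiv ℝ Φ.X z (0, 1, 0) = δ₁ := fun z hz =>
    eq_of_fderiv_eq_zero (f := fun z => fderiv ℝ Φ.X z (0, 1, 0)) hconv hXxsm
      (fun z hz => mixed_fderiv_eq_zero hΩ (fun z hz => (hreg z hz).smooth_X) hXt _ hz) hXxx
      (fun z hz => mixed_fderiv_eq_zero hΩ (fun z hz => (hreg z hz).smooth_X) hXu _ hz) hz₀ hz
  have hXaff : ∀ z ∈ Ω, Φ.X z = δ₁ * z.2.1 + (Φ.X (t₀, x₀, u₀) - δ₁ * x₀) := by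
    intro z hz
    have hfd : ∀ z ∈ Ω, ∀ e : ℝ × ℝ × ℝ,
        fderiv ℝ (fun z : ℝ × ℝ × ℝ => Φ.X z - δ₁ * z.2.1) z e
          = fderiv ℝ Φ.X z e - δ₁ * e.2.1 := by
      intro z hz e
      have hl : HasFDerivAt (fun z : ℝ × ℝ × ℝ => δ₁ * z.2.1)
          (δ₁ • ((ContinuousLinearMap.fst ℝ ℝ ℝ).comp (ContinuousLinearMap.snd ℝ ℝ (ℝ × ℝ)))) z :=
        ((hasFDerivAt_fst).comp z hasFDerivAt_snd).const_mul _
      have := (((hreg z hz).smooth_X.differentiableAt (by simp)).hasFDerivAt.sub hl).fderiv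
      exact DFunLike.congr_fun this e
    have := eq_of_fderiv_eq_zero hconv (f := fun z : ℝ × ℝ × ℝ => Φ.X z - δ₁ * z.2.1)
      (fun z hz => (hreg z hz).smooth_X.sub (by fun_prop))
      (fun z hz => by rw [hfd _ hz, hXt z hz]; ring)
      (fun z hz => by rw [hfd _ hz, hXxc z hz]; ring)
      (fun z hz => by rw [hfd _ hz, hXu z hz]; ring) hz₀ hz
    simp only at this
    linear_combination this
  refine ⟨τ, δ₁, Φ.X (t₀, x₀, u₀) - δ₁ * x₀, δ₃, hτs, fun t ht => (hτ t ht).1, hδ₁0, hδ₃0,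
    fun t x u hz => ⟨hT _ hz, hXaff _ hz, by rw [hUaff _ hz, hδ₀0, add_zero]⟩, ?_⟩
  intro t x u hz a b s ha hb hs n hn
  obtain ⟨θ', -, hval, hm⟩ := hmap a b s ha hb hs n hn
  obtain ⟨hA, hB, hS, hN⟩ := hval _ hz
  -- The coefficient relations depend on `t` only, so they may be read off at another point of the
  -- fibre where `u ≠ 0`.
  obtain ⟨v, hv, hv0⟩ := exists_off_zero hΩ hz
  obtain ⟨e1, e2, -, -⟩ := hrig t x v hv hv0 a b s ha n hn θ' hm
  have e3 := (hrel t x v hv hv0 a b s n θ' hm).2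
  have e4 := (hX' t x v hv hv0).2.2.2 a b s hs n θ' hm
  rw [hXxc _ hv] at e2 e3 e4
  have hk0 := hk hz
  have hδn : δ₃ ^ n ≠ 0 := zpow_ne_zero _ hδ₃0
  rw [hT _ hz] at hA hB hS
  rw [← hA, ← hB, ← hS, ← hN]
  refine ⟨?_, ?_, ?_, e1⟩
  · field_simp
    linear_combination e2
  · field_simp
    linear_combination e3
  · field_simp
    linear_combination e4

/-! ### Sufficiency of the asserted form. -/

theorem iteratedDeriv_comp_affine (f : ℝ → ℝ) (c d : ℝ) (n : ℕ) :
    iteratedDeriv n (fun x => f (c * x + d)) = fun x => c ^ n * iteratedDeriv n f (c * x + d) := by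
  induction n with
  | zero => simp
  | succ n ih =>
    funext x
    rw [iteratedDeriv_succ, ih, deriv_const_mul_field]
    have := deriv_comp_mul_left c (fun y => iteratedDeriv n f (y + d)) x
    rw [deriv_comp_add_const, smul_eq_mul, ← iteratedDeriv_succ] at this
    rw [this]
    ring

/-- On a vector with no `π`-component the derivative of the multiplier drops out of the product
rule. This treats each coefficient row of the extended Jacobian, with `π` the time coordinate. -/
theorem fderiv_kernel_of_eventuallyEq {V : Type*} [NormedAddCommGroup V] [NormedSpace ℝ V]
    {F : V → ℝ} {L : V →L[ℝ] ℝ} {p v : V} (hF : HasFDerivAt F L p) {m : ℝ → ℝ} {π ρ : V →L[ℝ] ℝ}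
    (hm : DifferentiableAt ℝ m (π p)) (hm0 : m (π p) ≠ 0)
    (heq : F =ᶠ[𝓝 p] fun y => m (π y) * ρ y) (hv : L v = 0) (hπ : π v = 0) : ρ v = 0 := by
  have h1 : HasFDerivAt (fun y => m (π y) * ρ y) _ p :=
    (hm.hasDerivAt.comp_hasFDerivAt p π.hasFDerivAt).mul ρ.hasFDerivAt
  have h2 := DFunLike.congr_fun (hF.unique (h1.congr_of_eventuallyEq heq)) v
  simp only [hv, add_apply, smul_apply, hπ, smul_eq_mul, mul_zero, add_zero,
    Function.comp_apply] at h2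
  exact (mul_eq_zero.1 h2.symm).resolve_left hm0

theorem injOn_of_deriv_ne_zero {I : Set ℝ} (hI : Convex ℝ I) {τ : ℝ → ℝ} (hτ : ContinuousOn τ I)
    (h : ∀ t ∈ I, deriv τ t ≠ 0) : InjOn τ I := by
  have key : ∀ a ∈ I, ∀ b ∈ I, a < b → τ a ≠ τ b := by
    intro a ha b hb hab heq
    have hsub : Icc a b ⊆ I := hI.ordConnected.out ha hb
    obtain ⟨c, hc, hc0⟩ := exists_deriv_eq_zero hab (hτ.mono hsub) heq
    exact h c (hsub (Ioo_subset_Icc_self hc)) hc0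
  intro a ha b hb heq
  rcases lt_trichotomy a b with hab | hab | hab
  · exact absurd heq (key a ha b hb hab)
  · exact hab
  · exact absurd heq.symm (key b hb a ha hab)

/-- Injectivity on `I` forces the global inverse to coincide near `τ t` with the smooth one from the
inverse function theorem. -/
theorem contDiffAt_invFunOn {I : Set ℝ} (hI : IsOpen I) {τ : ℝ → ℝ} (hτ : ContDiffOn ℝ ∞ τ I)
    (hinj : InjOn τ I) {t : ℝ} (ht : t ∈ I) (h : deriv τ t ≠ 0) :
    ContDiffAt ℝ ∞ (Function.invFunOn τ I) (τ t) := by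
  have hc : ContDiffAt ℝ ∞ τ t := hτ.contDiffAt (hI.mem_nhds ht)
  have hd := (hc.differentiableAt (by simp)).hasDerivAt.hasFDerivAt_equiv h
  have hs := hc.hasStrictFDerivAt' hd (by simp)
  refine (hc.to_localInverse hd (by simp)).congr_of_eventuallyEq ?_
  have h1 : Tendsto (hc.localInverse hd (by simp)) (𝓝 (τ t)) (𝓝 t) := by
    have := (hc.to_localInverse hd (by simp)).continuousAt.tendsto
    rwa [hc.localInverse_apply_image hd (by simp)] at this
  filter_upwards [hs.eventually_right_inverse, h1.eventually (hI.mem_nhds ht)] with y hy hyI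
  have := hinj.leftInvOn_invFunOn hyI
  rw [← this]
  congr 1
  exact hy.symm

/-- By the chain rule, `τ'` times the left side of the target equation is `δ₃` times that of the
source equation, and both factors are nonzero. -/
theorem mapsEquation_of_form {Ω : Set (ℝ × ℝ × ℝ)} (hΩ : IsOpen Ω) {Φ : Transformation}
    {τ : ℝ → ℝ} {δ₁ δ₂ δ₃ : ℝ} (hδ₁ : δ₁ ≠ 0) (hδ₃ : δ₃ ≠ 0)
    (hτd : ∀ t ∈ Prod.fst '' Ω, HasDerivAt τ (deriv τ t) t)
    (hτ0 : ∀ t ∈ Prod.fst '' Ω, deriv τ t ≠ 0)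
    (hΦ : ∀ t x u : ℝ, (t, x, u) ∈ Ω →
      Φ.T (t, x, u) = τ t ∧ Φ.X (t, x, u) = δ₁ * x + δ₂ ∧ Φ.U (t, x, u) = δ₃ * u)
    {θ θ' : Elements} (hn : θ'.n = θ.n)
    (hα : ∀ t ∈ Prod.fst '' Ω, θ'.α (τ t) = δ₁ / (δ₃ ^ θ.n * deriv τ t) * θ.α t)
    (hβ : ∀ t ∈ Prod.fst '' Ω, θ'.β (τ t) = δ₁ ^ 3 / deriv τ t * θ.β t)
    (hσ : ∀ t ∈ Prod.fst '' Ω, θ'.σ (τ t) = δ₁ ^ 5 / deriv τ t * θ.σ t) :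
    Φ.MapsEquation Ω θ θ' := by
  intro u v t x hz hu hv hm
  have ht : t ∈ Prod.fst '' Ω := ⟨_, hz, rfl⟩
  have hζ : Φ.alongGraph u (t, x) = (τ t, δ₁ * x + δ₂) :=
    Prod.ext (hΦ _ _ _ hz).1 (hΦ _ _ _ hz).2.1
  rw [hζ] at hv ⊢
  have hev : ∀ᶠ q in 𝓝 (t, x), v (τ q.1) (δ₁ * q.2 + δ₂) = δ₃ * u q.1 q.2 := by
    filter_upwards [hm.2, (contDiffAt_graphMap hu).continuousAt.eventually_mem (hΩ.mem_nhds hz)]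
      with q h1 h2
    obtain ⟨e1, e2, e3⟩ := hΦ _ _ _ h2
    have h3 : Φ.alongGraph u q = (τ q.1, δ₁ * q.2 + δ₂) := Prod.ext e1 e2
    rw [h3, e3] at h1
    exact h1
  have hv0 : v (τ t) (δ₁ * x + δ₂) = δ₃ * u t x := hev.self_of_nhds
  have hit : ∀ k : ℕ, δ₁ ^ k * iteratedDeriv k (v (τ t)) (δ₁ * x + δ₂)
      = δ₃ * iteratedDeriv k (u t) x := by
    intro k
    have hc : Tendsto (fun y : ℝ => (t, y)) (𝓝 x) (𝓝 (t, x)) :=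
      (by fun_prop : Continuous fun y : ℝ => (t, y)).tendsto x
    have h1 : (fun y => v (τ t) (δ₁ * y + δ₂)) =ᶠ[𝓝 x] fun y => δ₃ * u t y := hc.eventually hev
    have h2 := h1.iteratedDeriv_eq k
    rw [iteratedDeriv_comp_affine, iteratedDeriv_const_mul_field] at h2
    exact h2
  have hdt : deriv (fun r => v r (δ₁ * x + δ₂)) (τ t) * deriv τ t
      = δ₃ * deriv (fun r => u r x) t := by
    have hc : Tendsto (fun r : ℝ => (r, x)) (𝓝 t) (𝓝 (t, x)) :=
      (by fun_prop : Continuous fun r : ℝ => (r, x)).tendsto t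
    have h1 : (fun r => v (τ r) (δ₁ * x + δ₂)) =ᶠ[𝓝 t] fun r => δ₃ * u r x := hc.eventually hev
    have h2 : ContDiffAt ℝ ∞ (fun r => v r (δ₁ * x + δ₂)) (τ t) :=
      ContDiffAt.comp (g := Function.uncurry v) (f := fun r : ℝ => (r, δ₁ * x + δ₂)) (τ t) hv
        (contDiffAt_id.prodMk contDiffAt_const)
    have h3 := ((h2.differentiableAt (by simp)).hasDerivAt.comp t (hτd t ht)).deriv
    have h4 := h1.deriv_eq
    rw [deriv_const_mul_field] at h4
    rw [← h4, ← h3]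
    rfl
  have h1 := hit 1
  have h3 := hit 3
  have h5 := hit 5
  simp only [iteratedDeriv_one, pow_one] at h1
  have hk := hτ0 t ht
  have hδn : δ₃ ^ θ.n ≠ 0 := zpow_ne_zero _ hδ₃
  unfold SatisfiesAt
  simp only [hv0, hn, hα t ht, hβ t ht, hσ t ht, mul_zpow]
  refine and_congr (by simp [hδ₃]) ?_
  have e : δ₁ / (δ₃ ^ θ.n * deriv τ t) * θ.α t * (δ₃ ^ θ.n * u t x ^ θ.n)
      = θ.α t * u t x ^ θ.n * δ₁ / deriv τ t := by field_simp
  rw [e]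
  have e2 : deriv τ t * (deriv (fun s => v s (δ₁ * x + δ₂)) (τ t)
      + θ.α t * u t x ^ θ.n * δ₁ / deriv τ t * deriv (v (τ t)) (δ₁ * x + δ₂)
      + δ₁ ^ 3 / deriv τ t * θ.β t * iteratedDeriv 3 (v (τ t)) (δ₁ * x + δ₂)
      + δ₁ ^ 5 / deriv τ t * θ.σ t * iteratedDeriv 5 (v (τ t)) (δ₁ * x + δ₂))
      = δ₃ * (deriv (fun s => u s x) t + θ.α t * u t x ^ θ.n * deriv (u t) x
      + θ.β t * iteratedDeriv 3 (u t) x + θ.σ t * iteratedDeriv 5 (u t) x) := by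
    field_simp
    linear_combination hdt + θ.α t * u t x ^ θ.n * h1 + θ.β t * h3 + θ.σ t * h5
  constructor
  · intro h
    rw [h, mul_zero] at e2
    exact (mul_eq_zero.1 e2).resolve_left hk
  · intro h
    rw [h, mul_zero] at e2
    exact (mul_eq_zero.1 e2.symm).resolve_left hδ₃

section Form

variable {E : Set ℤ} {Ω : Set (ℝ × ℝ × ℝ)} {Φ : Transformation} {τ : ℝ → ℝ} {δ₁ δ₂ δ₃ : ℝ}

/-- The extended transformation in coordinates, for a transformation of the asserted form. -/
noncomputable def standardForm (τ : ℝ → ℝ) (δ₁ δ₂ δ₃ : ℝ) (n : ℤ) (p : (ℝ × ℝ × ℝ) × (ℝ × ℝ × ℝ)) :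
    (ℝ × ℝ × ℝ) × (ℝ × ℝ × ℝ) :=
  ((τ p.1.1, δ₁ * p.1.2.1 + δ₂, δ₃ * p.1.2.2),
    (δ₁ / (δ₃ ^ n * deriv τ p.1.1) * p.2.1, δ₁ ^ 3 / deriv τ p.1.1 * p.2.2.1,
      δ₁ ^ 5 / deriv τ p.1.1 * p.2.2.2))

theorem contDiffAt_standardForm {n : ℤ} (hδ₃ : δ₃ ≠ 0) {p : (ℝ × ℝ × ℝ) × (ℝ × ℝ × ℝ)}
    (hτ : ContDiffAt ℝ ∞ τ p.1.1) (hτ' : ContDiffAt ℝ ∞ (deriv τ) p.1.1)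
    (h : deriv τ p.1.1 ≠ 0) : ContDiffAt ℝ ∞ (standardForm τ δ₁ δ₂ δ₃ n) p := by
  have h1 : ContDiffAt ℝ ∞ (fun p : (ℝ × ℝ × ℝ) × (ℝ × ℝ × ℝ) => τ p.1.1) p :=
    ContDiffAt.comp (g := τ) p hτ (by fun_prop)
  have h2 : ContDiffAt ℝ ∞ (fun p : (ℝ × ℝ × ℝ) × (ℝ × ℝ × ℝ) => deriv τ p.1.1) p :=
    ContDiffAt.comp (g := deriv τ) p hτ' (by fun_prop)
  have hδn : δ₃ ^ n ≠ 0 := zpow_ne_zero _ hδ₃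
  unfold standardForm
  refine (h1.prodMk (ContDiffAt.prodMk (by fun_prop) (by fun_prop))).prodMk
    (ContDiffAt.prodMk ?_ (ContDiffAt.prodMk ?_ ?_))
  · exact (contDiffAt_const.div (contDiffAt_const.mul h2) (mul_ne_zero hδn h)).mul (by fun_prop)
  · exact (contDiffAt_const.div h2 h).mul (by fun_prop)
  · exact (contDiffAt_const.div h2 h).mul (by fun_prop)

theorem bijective_fderiv_standardForm {n : ℤ} (hδ₁ : δ₁ ≠ 0) (hδ₃ : δ₃ ≠ 0)
    {p : (ℝ × ℝ × ℝ) × (ℝ × ℝ × ℝ)}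
    (hτ : ContDiffAt ℝ ∞ τ p.1.1) (hτ' : ContDiffAt ℝ ∞ (deriv τ) p.1.1)
    (h : deriv τ p.1.1 ≠ 0) :
    Function.Bijective (fderiv ℝ (standardForm τ δ₁ δ₂ δ₃ n) p) := by
  set L := fderiv ℝ (standardForm τ δ₁ δ₂ δ₃ n) p with hLdef
  have hL : HasFDerivAt (standardForm τ δ₁ δ₂ δ₃ n) L p :=
    ((contDiffAt_standardForm hδ₃ hτ hτ' h).differentiableAt (by simp)).hasFDerivAt
  let V := (ℝ × ℝ × ℝ) × (ℝ × ℝ × ℝ)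
  let π₁ : V →L[ℝ] ℝ :=
    (ContinuousLinearMap.fst ℝ ℝ (ℝ × ℝ)).comp (ContinuousLinearMap.fst ℝ (ℝ × ℝ × ℝ) (ℝ × ℝ × ℝ))
  let π₂ : V →L[ℝ] ℝ := ((ContinuousLinearMap.fst ℝ ℝ ℝ).comp
    (ContinuousLinearMap.snd ℝ ℝ (ℝ × ℝ))).comp (ContinuousLinearMap.fst ℝ (ℝ × ℝ × ℝ) (ℝ × ℝ × ℝ))
  let π₃ : V →L[ℝ] ℝ := ((ContinuousLinearMap.snd ℝ ℝ ℝ).comp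
    (ContinuousLinearMap.snd ℝ ℝ (ℝ × ℝ))).comp (ContinuousLinearMap.fst ℝ (ℝ × ℝ × ℝ) (ℝ × ℝ × ℝ))
  let ρ₁ : V →L[ℝ] ℝ :=
    (ContinuousLinearMap.fst ℝ ℝ (ℝ × ℝ)).comp (ContinuousLinearMap.snd ℝ (ℝ × ℝ × ℝ) (ℝ × ℝ × ℝ))
  let ρ₂ : V →L[ℝ] ℝ := ((ContinuousLinearMap.fst ℝ ℝ ℝ).comp
    (ContinuousLinearMap.snd ℝ ℝ (ℝ × ℝ))).comp (ContinuousLinearMap.snd ℝ (ℝ × ℝ × ℝ) (ℝ × ℝ × ℝ))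
  let ρ₃ : V →L[ℝ] ℝ := ((ContinuousLinearMap.snd ℝ ℝ ℝ).comp
    (ContinuousLinearMap.snd ℝ ℝ (ℝ × ℝ))).comp (ContinuousLinearMap.snd ℝ (ℝ × ℝ × ℝ) (ℝ × ℝ × ℝ))
  have hδn : δ₃ ^ n ≠ 0 := zpow_ne_zero _ hδ₃
  have hdτ' : DifferentiableAt ℝ (deriv τ) (π₁ p) := hτ'.differentiableAt (by simp)
  have hinj : Function.Injective (L : V →ₗ[ℝ] V) := by
    rw [← LinearMap.ker_eq_bot, LinearMap.ker_eq_bot']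
    intro v hv
    have hv' : L v = 0 := hv
    have e1 : π₁ v = 0 := by
      have h1 : HasFDerivAt (fun q : V => τ (π₁ q)) (deriv τ p.1.1 • π₁) p :=
        HasDerivAt.comp_hasFDerivAt p (hτ.differentiableAt (by simp)).hasDerivAt π₁.hasFDerivAt
      have h2 := DFunLike.congr_fun (hL.fst.fst.unique h1) v
      have h3 : (0 : ℝ) = deriv τ p.1.1 * π₁ v := by
        rw [← smul_eq_mul, ← smul_apply, ← h2]
        exact (congrArg (fun y : V => y.1.1) hv').symm
      exact (mul_eq_zero.1 h3.symm).resolve_left h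
    have e2 : π₂ v = 0 := by
      have h1 : HasFDerivAt (fun q : V => δ₁ * π₂ q + δ₂) (δ₁ • π₂) p :=
        (π₂.hasFDerivAt.const_mul δ₁).add_const δ₂
      have h2 := DFunLike.congr_fun (hL.fst.snd.fst.unique h1) v
      have h3 : (0 : ℝ) = δ₁ * π₂ v := by
        rw [← smul_eq_mul, ← smul_apply, ← h2]
        exact (congrArg (fun y : V => y.1.2.1) hv').symm
      exact (mul_eq_zero.1 h3.symm).resolve_left hδ₁
    have e3 : π₃ v = 0 := by
      have h1 : HasFDerivAt (fun q : V => δ₃ * π₃ q) (δ₃ • π₃) p := π₃.hasFDerivAt.const_mul δ₃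
      have h2 := DFunLike.congr_fun (hL.fst.snd.snd.unique h1) v
      have h3 : (0 : ℝ) = δ₃ * π₃ v := by
        rw [← smul_eq_mul, ← smul_apply, ← h2]
        exact (congrArg (fun y : V => y.1.2.2) hv').symm
      exact (mul_eq_zero.1 h3.symm).resolve_left hδ₃
    have e4 : ρ₁ v = 0 := fderiv_kernel_of_eventuallyEq hL.snd.fst
      (m := fun t => δ₁ / (δ₃ ^ n * deriv τ t)) (π := π₁) (ρ := ρ₁)
      ((differentiableAt_const _).div (hdτ'.const_mul _) (mul_ne_zero hδn h))
      (div_ne_zero hδ₁ (mul_ne_zero hδn h)) EventuallyEq.rfl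
      (congrArg (fun y : V => y.2.1) hv') e1
    have e5 : ρ₂ v = 0 := fderiv_kernel_of_eventuallyEq hL.snd.snd.fst
      (m := fun t => δ₁ ^ 3 / deriv τ t) (π := π₁) (ρ := ρ₂)
      ((differentiableAt_const _).div hdτ' h)
      (div_ne_zero (pow_ne_zero _ hδ₁) h) EventuallyEq.rfl
      (congrArg (fun y : V => y.2.2.1) hv') e1
    have e6 : ρ₃ v = 0 := fderiv_kernel_of_eventuallyEq hL.snd.snd.snd
      (m := fun t => δ₁ ^ 5 / deriv τ t) (π := π₁) (ρ := ρ₃)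
      ((differentiableAt_const _).div hdτ' h)
      (div_ne_zero (pow_ne_zero _ hδ₁) h) EventuallyEq.rfl
      (congrArg (fun y : V => y.2.2.2) hv') e1
    exact Prod.ext (Prod.ext e1 (Prod.ext e2 e3)) (Prod.ext e4 (Prod.ext e5 e6))
  exact ⟨hinj, LinearMap.injective_iff_surjective.1 hinj⟩

/-- The transformations of the asserted form constitute usual equivalence transformations. -/
theorem isUsualEquivalence_of_form (hΩ : IsOpen Ω) (hconv : Convex ℝ Ω)
    (hτ : ContDiffOn ℝ ∞ τ (Prod.fst '' Ω)) (hτ0 : ∀ t ∈ Prod.fst '' Ω, deriv τ t ≠ 0)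
    (hδ₁ : δ₁ ≠ 0) (hδ₃ : δ₃ ≠ 0)
    (hΦ : ∀ t x u : ℝ, (t, x, u) ∈ Ω →
      Φ.T (t, x, u) = τ t ∧ Φ.X (t, x, u) = δ₁ * x + δ₂ ∧ Φ.U (t, x, u) = δ₃ * u)
    (hc : ∀ t x u : ℝ, (t, x, u) ∈ Ω →
      ∀ a b s : ℝ, a ≠ 0 → b ≠ 0 → s ≠ 0 → ∀ n ∈ E,
        Φ.A (t, x, u) (a, b, s) n = δ₁ / (δ₃ ^ n * deriv τ t) * a ∧
        Φ.B (t, x, u) (a, b, s) n = δ₁ ^ 3 / deriv τ t * b ∧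
        Φ.S (t, x, u) (a, b, s) n = δ₁ ^ 5 / deriv τ t * s ∧
        Φ.N (t, x, u) (a, b, s) n = n) :
    IsUsualEquivalence E Ω Φ := by
  have hI : IsOpen (Prod.fst '' Ω) := isOpenMap_fst _ hΩ
  have hIconv : Convex ℝ (Prod.fst '' Ω) := hconv.linear_image (LinearMap.fst ℝ ℝ (ℝ × ℝ))
  have hτc : ∀ t ∈ Prod.fst '' Ω, ContDiffAt ℝ ∞ τ t := fun t ht => hτ.contDiffAt (hI.mem_nhds ht)
  have hτ' : ∀ t ∈ Prod.fst '' Ω, ContDiffAt ℝ ∞ (deriv τ) t := fun t ht =>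
    (hτ.deriv_of_isOpen hI (m := ∞) (by simp)).contDiffAt (hI.mem_nhds ht)
  have hext : ∀ n ∈ E, ∀ p ∈ Ω ×ˢ coeffSpace, Φ.extended n p = standardForm τ δ₁ δ₂ δ₃ n p := by
    rintro n hn ⟨⟨t, x, u⟩, ⟨a, b, s⟩⟩ ⟨hz, ha, hb, hs⟩
    obtain ⟨e1, e2, e3⟩ := hΦ t x u hz
    obtain ⟨e4, e5, e6, -⟩ := hc t x u hz a b s ha hb hs n hn
    simp only [Transformation.extended, standardForm, e1, e2, e3, e4, e5, e6]
  have hopen : IsOpen (Ω ×ˢ coeffSpace) := hΩ.prod isOpen_coeffSpace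
  refine ⟨?_, ?_, ?_⟩
  · intro n hn
    refine ContDiffOn.congr (f := standardForm τ δ₁ δ₂ δ₃ n) (fun p hp => ?_) (hext n hn)
    have ht : p.1.1 ∈ Prod.fst '' Ω := ⟨_, hp.1, rfl⟩
    exact (contDiffAt_standardForm hδ₃ (hτc _ ht) (hτ' _ ht) (hτ0 _ ht)).contDiffWithinAt
  · intro n hn p hp
    have ht : p.1.1 ∈ Prod.fst '' Ω := ⟨_, hp.1, rfl⟩
    have : Φ.extended n =ᶠ[𝓝 p] standardForm τ δ₁ δ₂ δ₃ n := by
      filter_upwards [hopen.mem_nhds hp] with y hy using hext n hn y hy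
    rw [this.fderiv_eq]
    exact bijective_fderiv_standardForm hδ₁ hδ₃ (hτc _ ht) (hτ' _ ht) (hτ0 _ ht)
  · intro θ hθ
    -- The new coefficients must be single-valued functions of the new time. Convexity makes the
    -- projection an interval, on which Rolle's theorem gives injectivity of `τ`.
    have hinj : InjOn τ (Prod.fst '' Ω) := injOn_of_deriv_ne_zero hIconv hτ.continuousOn hτ0
    set g := Function.invFunOn τ (Prod.fst '' Ω) with hg
    have hgτ : ∀ t ∈ Prod.fst '' Ω, g (τ t) = t := fun t ht => hinj.leftInvOn_invFunOn ht
    have hgc : ∀ t ∈ Prod.fst '' Ω, ContDiffAt ℝ ∞ g (τ t) := fun t ht =>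
      contDiffAt_invFunOn hI hτ hinj ht (hτ0 t ht)
    have himg : ∀ y ∈ Φ.T '' Ω, ∃ t ∈ Prod.fst '' Ω, y = τ t := by
      rintro _ ⟨⟨t, x, u⟩, hz, rfl⟩
      exact ⟨t, ⟨_, hz, rfl⟩, (hΦ t x u hz).1⟩
    have hcomp : ∀ f : ℝ → ℝ, ContDiffOn ℝ ∞ f (Prod.fst '' Ω) → ∀ t ∈ Prod.fst '' Ω,
        ContDiffAt ℝ ∞ (fun y => f (g y)) (τ t) := by
      intro f hf t ht
      refine ContDiffAt.comp (g := f) (τ t) ?_ (hgc t ht)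
      rw [hgτ t ht]
      exact hf.contDiffAt (hI.mem_nhds ht)
    have hdτ : ∀ t ∈ Prod.fst '' Ω, ContDiffAt ℝ ∞ (fun y => deriv τ (g y)) (τ t) :=
      hcomp _ fun t ht => (hτ' t ht).contDiffWithinAt
    have hδn : δ₃ ^ θ.n ≠ 0 := zpow_ne_zero _ hδ₃
    refine ⟨⟨fun y => δ₁ / (δ₃ ^ θ.n * deriv τ (g y)) * θ.α (g y),
      fun y => δ₁ ^ 3 / deriv τ (g y) * θ.β (g y),
      fun y => δ₁ ^ 5 / deriv τ (g y) * θ.σ (g y), θ.n⟩, ?_, ?_, ?_⟩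
    · refine ⟨?_, ?_, ?_, ?_, ?_, ?_, hθ.n_mem⟩ <;> intro y hy <;>
        obtain ⟨t, ht, rfl⟩ := himg y hy
      · exact ((contDiffAt_const.div (contDiffAt_const.mul (hdτ t ht))
          (mul_ne_zero hδn (by rw [hgτ t ht]; exact hτ0 t ht))).mul
          (hcomp _ hθ.smooth_α t ht)).contDiffWithinAt
      · exact ((contDiffAt_const.div (hdτ t ht) (by rw [hgτ t ht]; exact hτ0 t ht)).mul
          (hcomp _ hθ.smooth_β t ht)).contDiffWithinAt
      · exact ((contDiffAt_const.div (hdτ t ht) (by rw [hgτ t ht]; exact hτ0 t ht)).mul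
          (hcomp _ hθ.smooth_σ t ht)).contDiffWithinAt
      · simp only [hgτ t ht]
        exact mul_ne_zero (div_ne_zero hδ₁ (mul_ne_zero hδn (hτ0 t ht))) (hθ.α_ne_zero t ht)
      · simp only [hgτ t ht]
        exact mul_ne_zero (div_ne_zero (pow_ne_zero _ hδ₁) (hτ0 t ht)) (hθ.β_ne_zero t ht)
      · simp only [hgτ t ht]
        exact mul_ne_zero (div_ne_zero (pow_ne_zero _ hδ₁) (hτ0 t ht)) (hθ.σ_ne_zero t ht)
    · rintro ⟨t, x, u⟩ hz
      have ht : t ∈ Prod.fst '' Ω := ⟨_, hz, rfl⟩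
      obtain ⟨e1, e2, e3, e4⟩ := hc t x u hz _ _ _ (hθ.α_ne_zero t ht) (hθ.β_ne_zero t ht)
        (hθ.σ_ne_zero t ht) θ.n hθ.n_mem
      simp only [(hΦ t x u hz).1, hgτ t ht, e1, e2, e3, e4, and_self]
    · exact mapsEquation_of_form hΩ hδ₁ hδ₃
        (fun t ht => ((hτc t ht).differentiableAt (by simp)).hasDerivAt) hτ0 hΦ rfl
        (fun t ht => by simp only [hgτ t ht]) (fun t ht => by simp only [hgτ t ht])
        (fun t ht => by simp only [hgτ t ht])

end Form

end Kawahara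

theorem theorem1 (E : Set ℤ) (hE : E.Nonempty) (hE0 : (0 : ℤ) ∉ E)
    (Ω : Set (ℝ × ℝ × ℝ)) (hΩ : IsOpen Ω) (hconv : Convex ℝ Ω) (hne : Ω.Nonempty)
    (Φ : Kawahara.Transformation) :
    Kawahara.IsUsualEquivalence E Ω Φ ↔
      ∃ (τ : ℝ → ℝ) (δ₁ δ₂ δ₃ : ℝ),
        ContDiffOn ℝ ∞ τ (Prod.fst '' Ω) ∧
        (∀ t ∈ Prod.fst '' Ω, deriv τ t ≠ 0) ∧
        δ₁ ≠ 0 ∧ δ₃ ≠ 0 ∧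
        (∀ t x u : ℝ, (t, x, u) ∈ Ω →
          Φ.T (t, x, u) = τ t ∧
          Φ.X (t, x, u) = δ₁ * x + δ₂ ∧
          Φ.U (t, x, u) = δ₃ * u) ∧
        (∀ t x u : ℝ, (t, x, u) ∈ Ω →
          ∀ a b s : ℝ, a ≠ 0 → b ≠ 0 → s ≠ 0 → ∀ n ∈ E,
            Φ.A (t, x, u) (a, b, s) n = δ₁ / (δ₃ ^ n * deriv τ t) * a ∧
            Φ.B (t, x, u) (a, b, s) n = δ₁ ^ 3 / deriv τ t * b ∧
            Φ.S (t, x, u) (a, b, s) n = δ₁ ^ 5 / deriv τ t * s ∧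
            Φ.N (t, x, u) (a, b, s) n = n) := by
  constructor
  · intro h
    exact h.form hE hE0 hΩ hconv hne
  · rintro ⟨τ, δ₁, δ₂, δ₃, hτ, hτ0, hδ₁, hδ₃, hΦ, hc⟩
    exact Kawahara.isUsualEquivalence_of_form hΩ hconv hτ hτ0 hδ₁ hδ₃ hΦ hc
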